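/- Consider four bodies in the plane with masses $m_1=m_2=m_3=1$, $m_4=m$ and total mass $M=3+m$. For $x=(\lambda_0,\mu,r_{12},r_{13},r_{14},r_{23},r_{24},r_{34})\in\mathbb R^8$ let $U=\sum_{i<j}m_im_j/r_{ij}$, $I=\frac1M\sum_{i<j}m_im_jr_{ij}^2$, and let $S$ be the Cayley--Menger determinant of the $r_{ij}$, that is, the determinant of the symmetric $5\times5$ matrix with zero diagonal whose first row is $(0,1,1,1,1)$ and whose other off-diagonal entries are the $r_{ij}^2$. Put $V=U+\lambda_0(I-1)+\mu S$. The Dziobek map $F(x,m)\in\mathbb R^8$ has the polynomial components $M\,\partial V/\partial\lambda_0$, $\partial V/\partial\mu$, and $M r_{ij}^2\,\partial V/\partial r_{ij}$ (in the order of the unknowns); the Dziobek equations are $F(x,m)=0$. Write $DF$ for the Jacobian matrix in $x$ and a subscript $m$ for the derivative in $m$. The dihedral group of order six $\{E,g_1,\dots,g_5\}$ acts on $\mathbb R^8$ by maps $\Phi_g$ that permute the $r_{ij}$ according to the permutations of the bodies $1,2,3$; here $g_1,g_2,g_3$ are the transpositions $(2\,3)$, $(1\,3)$, $(1\,2)$.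 Let $B\subset\mathbb R^8\times\mathbb R$ be the box of all $(x,m)$ with $\lambda_0=4.07733304636361696432719$, $\mu=0.777155400247894593452215$, $r_{12}=1.013474951606110121651278$, $r_{13}=r_{23}=0.57621299527180$, $r_{14}=r_{24}=0.995153301920946$, $r_{34}=0.582177257875351248071238$, $m=0.99184227439094091554349$, each of these nine coordinates being allowed, independently, an error of at most one unit in its last printed decimal. There is exactly one $(x_{**},m_{**})\in B$ with $F(x_{**},m_{**})=0$ and $\det DF(x_{**},m_{**})=0$. With $R=\Phi_{g_3}$ it satisfies $Rx_{**}=x_{**}$. The kernels of $A=DF(x_{**},m_{**})$ and of $A^T$ are one-dimensional, spanned by vectors $v$ and $w$ whose $r_{24}$-components are equal to $1$; moreover $Rv=-v$, and at $(x_{**},m_{**})$ $$w^TF_m=0,\quad w^T[DF_m\,v]>0,\quad w^T[D^2F(v,v)]=0,\quad w^T[D^3F(v,v,v)]<0 .$$ At $(x_{**},m_{**})$ the solutions of $F=0$ undergo a supercritical symmetry-breaking pitchfork bifurcation. That is, there are an open neighbourhood $W$ of $x_{**}$, numbers $\varepsilon,\delta>0$, and smooth curves $s:(m_{**}-\varepsilon,m_{**}+\varepsilon)\to\mathbb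 R^8$ and $(y,\tau):(-\delta,\delta)\to W\times\mathbb R$ with $s(m_{**})=y(0)=x_{**}$, $\tau(0)=m_{**}$, $y'(0)=v$, $\tau'(0)=0$, $\tau''(0)>0$, $F(y(t),\tau(t))=0$ for all $t$, such that the set of solutions of $F(x,m)=0$ in $W$ is $\{s(m)\}$ for $m_{**}-\varepsilon<m\le m_{**}$, and for $m_{**}<m<m_{**}+\varepsilon$ it consists of exactly three points $s(m)$, $y(t_1)$, $y(t_2)$ with $-\delta<t_1<0<t_2<\delta$ and $\tau(t_1)=\tau(t_2)=m$. The isotropy group of $s(m)$ is $\{E,g_3\}$ for all $m$ in the interval; the isotropy group of $y(t)$ is trivial for $t\ne0$; and $Ry(t)=y(-t)$, $\tau(-t)=\tau(t)$. All these solutions are the mutual distances of planar configurations in which body $3$ lies in the interior of the triangle formed by the other three. The same holds for the two other configurations of the orbit: for $\Phi_{g_1}x_{**}$ with reflection $g_2$, vectors $\Phi_{g_1}v,\Phi_{g_1}w$ and body $2$ inside, and for $\Phi_{g_2}x_{**}$ with reflection $g_1$, vectors $\Phi_{g_2}v,\Phi_{g_2}w$ and body $1$ inside: at each of them the conditions above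 and a supercritical symmetry-breaking pitchfork hold at $m=m_{**}$. -/

import Mathlib

open scoped ContDiff

noncomputable section

namespace FourBody

/-- The eight unknowns, in the order `(λ₀, μ, r₁₂, r₁₃, r₁₄, r₂₃, r₂₄, r₃₄)`. -/
abbrev Vec : Type := Fin 8 → ℝ

/-- The Cayley-Menger matrix of the six mutual distances. -/
def cayleyMenger (x : Vec) : Matrix (Fin 5) (Fin 5) ℝ :=
  !![0, 1, 1, 1, 1;
     1, 0, x 2 ^ 2, x 3 ^ 2, x 4 ^ 2;
     1, x 2 ^ 2, 0, x 5 ^ 2, x 6 ^ 2;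
     1, x 3 ^ 2, x 5 ^ 2, 0, x 7 ^ 2;
     1, x 4 ^ 2, x 6 ^ 2, x 7 ^ 2, 0]

/-- The Cayley-Menger determinant `S`. -/
def cmDet (x : Vec) : ℝ := (cayleyMenger x).det

/-- `pairMass m k = mᵢ mⱼ` for the pair `i < j` whose distance is the coordinate `k`, when the
masses are `1, 1, 1, m` (the first two entries belong to no pair and are not used). -/
def pairMass (m : ℝ) : Fin 8 → ℝ := ![0, 0, 1, 1, m, 1, m, m]

/-- The Newtonian potential `U = ∑ mᵢ mⱼ / rᵢⱼ`. -/
def potential (m : ℝ) (x : Vec) : ℝ := ∑ k ∈ Finset.Ici (2 : Fin 8), pairMass m k / x k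

/-- The moment of inertia `I = (∑ mᵢ mⱼ rᵢⱼ²) / M`, where `M = 3 + m` is the total mass. -/
def inertia (m : ℝ) (x : Vec) : ℝ :=
  (∑ k ∈ Finset.Ici (2 : Fin 8), pairMass m k * x k ^ 2) / (3 + m)

/-- The Lagrangian `U + λ₀ (I - 1) + μ S`. -/
def lagrangian (m : ℝ) (x : Vec) : ℝ :=
  potential m x + x 0 * (inertia m x - 1) + x 1 * cmDet x

/-- Partial derivative of a function of the eight unknowns in the `k`-th one. -/
def partialDeriv (f : Vec → ℝ) (k : Fin 8) (x : Vec) : ℝ :=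
  deriv (fun t => f (Function.update x k t)) (x k)

/-- The Dziobek map: the partial derivatives of the Lagrangian with denominators cleared.
The first component is `M ∂/∂λ₀`, the second is `∂/∂μ`, and the one that belongs to `rᵢⱼ`
is `M rᵢⱼ² ∂/∂rᵢⱼ`; see `dziobek_zero`, `dziobek_one` and `dziobek_dist`. -/
def dziobek (x : Vec) (m : ℝ) : Vec := fun k =>
  if k = 0 then (∑ l ∈ Finset.Ici (2 : Fin 8), pairMass m l * x l ^ 2) - (3 + m)
  else if k = 1 then cmDet x
  else -(3 + m) * pairMass m k + 2 * x 0 * pairMass m k * x k ^ 3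
    + x 1 * (3 + m) * x k ^ 2 * partialDeriv cmDet k x

/-- The Jacobian matrix `DF` of the Dziobek map in the eight unknowns. -/
def jacobian (x : Vec) (m : ℝ) : Matrix (Fin 8) (Fin 8) ℝ :=
  LinearMap.toMatrix' (fderiv ℝ (fun z => dziobek z m) x : Vec →ₗ[ℝ] Vec)

/-- The six elements of the dihedral group of order six. -/
inductive D6 : Type
  | e | g1 | g2 | g3 | g4 | g5

/-- The action of the dihedral group on the unknowns by relabelling the three equal masses. -/
def Phi : D6 → Vec → Vec
  | .e, x => x
  | .g1, x => ![x 0, x 1, x 3, x 2, x 4, x 5, x 7, x 6]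
  | .g2, x => ![x 0, x 1, x 5, x 3, x 7, x 2, x 6, x 4]
  | .g3, x => ![x 0, x 1, x 2, x 5, x 6, x 3, x 4, x 7]
  | .g4, x => ![x 0, x 1, x 3, x 5, x 7, x 2, x 4, x 6]
  | .g5, x => ![x 0, x 1, x 5, x 2, x 6, x 3, x 7, x 4]

/-- The isotropy group of a point. -/
def isotropy (x : Vec) : Set D6 := {g | Phi g x = x}

/-- The distances in `x` are those of four points of the plane, and the body `k` lies in the
interior of the triangle formed by the other three. -/
def BodyInside (k : Fin 4) (x : Vec) : Prop :=
  ∃ q : Fin 4 → EuclideanSpace ℝ (Fin 2),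
    dist (q 0) (q 1) = x 2 ∧ dist (q 0) (q 2) = x 3 ∧ dist (q 0) (q 3) = x 4 ∧
    dist (q 1) (q 2) = x 5 ∧ dist (q 1) (q 3) = x 6 ∧ dist (q 2) (q 3) = x 7 ∧
    q k ∈ interior (convexHull ℝ (q '' {k}ᶜ))

/-- The box that encloses the bifurcating solution: decimal centres, with an error of at most one
unit in the last decimal. -/
def xBox : Set Vec :=
  {x | |x 0 - 4.07733304636361696432719| ≤ 1 / 10 ^ 23 ∧
       |x 1 - 0.777155400247894593452215| ≤ 1 / 10 ^ 24 ∧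
       |x 2 - 1.013474951606110121651278| ≤ 1 / 10 ^ 24 ∧
       |x 3 - 0.57621299527180| ≤ 1 / 10 ^ 14 ∧
       |x 4 - 0.995153301920946| ≤ 1 / 10 ^ 15 ∧
       |x 5 - 0.57621299527180| ≤ 1 / 10 ^ 14 ∧
       |x 6 - 0.995153301920946| ≤ 1 / 10 ^ 15 ∧
       |x 7 - 0.582177257875351248071238| ≤ 1 / 10 ^ 24}

/-- The interval that encloses the bifurcation value of the mass. -/
def mBox : Set ℝ := {m | |m - 0.99184227439094091554349| ≤ 1 / 10 ^ 23}

/-- `x` solves the Dziobek equations at `m` and the Jacobian determinant vanishes there. -/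
def IsSingularSolution (x : Vec) (m : ℝ) : Prop :=
  dziobek x m = 0 ∧ (jacobian x m).det = 0

/-- The data of a symmetry-breaking pitchfork at `(x, m)`: `DF` has the one-dimensional kernel
spanned by `v`, its transpose has the one-dimensional kernel spanned by `w`, the reflection `g`
fixes `x` and reverses `v`, and
`wᵀ F_m = 0`, `wᵀ DF_m v > 0`, `wᵀ D²F(v,v) = 0`, `wᵀ D³F(v,v,v) < 0`. -/
structure PitchforkConditions (g : D6) (x : Vec) (m : ℝ) (v w : Vec) : Prop where
  v_ne : v ≠ 0
  w_ne : w ≠ 0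
  ker : LinearMap.ker (jacobian x m).mulVecLin = Submodule.span ℝ {v}
  coker : LinearMap.ker (jacobian x m).transpose.mulVecLin = Submodule.span ℝ {w}
  fix : Phi g x = x
  anti : Phi g v = -v
  first : w ⬝ᵥ deriv (fun μ => dziobek x μ) m = 0
  mixed : 0 < w ⬝ᵥ deriv (fun μ => fderiv ℝ (fun z => dziobek z μ) x v) m
  second : w ⬝ᵥ iteratedFDeriv ℝ 2 (fun z => dziobek z m) x ![v, v] = 0
  third : w ⬝ᵥ iteratedFDeriv ℝ 3 (fun z => dziobek z m) x ![v, v, v] < 0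

/-- The zero set of `F` near `(x₀, μ₀)` is a supercritical pitchfork: in `W × (μ₀ - ε, μ₀ + ε)` it
consists of the graph of the smooth curve `s` and of the smooth curve `t ↦ (y t, τ t)`, which is
tangent to the fibre `μ = μ₀` and bends towards `μ > μ₀`. So there is exactly one zero for
`μ ≤ μ₀` and there are exactly three for `μ > μ₀`. -/
structure IsSupercriticalPitchfork {E : Type*} [NormedAddCommGroup E] [NormedSpace ℝ E]
    (F : E → ℝ → E) (x₀ : E) (μ₀ : ℝ) (W : Set E) (ε δ : ℝ)
    (s : ℝ → E) (y : ℝ → E) (τ : ℝ → ℝ) : Prop where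
  isOpen : IsOpen W
  mem : x₀ ∈ W
  ε_pos : 0 < ε
  δ_pos : 0 < δ
  s_smooth : ContDiffOn ℝ ∞ s (Set.Ioo (μ₀ - ε) (μ₀ + ε))
  s_base : s μ₀ = x₀
  y_smooth : ContDiffOn ℝ ∞ y (Set.Ioo (-δ) δ)
  τ_smooth : ContDiffOn ℝ ∞ τ (Set.Ioo (-δ) δ)
  y_base : y 0 = x₀
  τ_base : τ 0 = μ₀
  y_tangent : deriv y 0 ≠ 0
  τ_tangent : deriv τ 0 = 0
  τ_bend : 0 < deriv (deriv τ) 0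
  y_zero : ∀ t ∈ Set.Ioo (-δ) δ, y t ∈ W ∧ F (y t) (τ t) = 0
  below : ∀ μ ∈ Set.Ioc (μ₀ - ε) μ₀, {x ∈ W | F x μ = 0} = {s μ}
  above : ∀ μ ∈ Set.Ioo μ₀ (μ₀ + ε), ∃ t₁ ∈ Set.Ioo (-δ) 0, ∃ t₂ ∈ Set.Ioo 0 δ,
    τ t₁ = μ ∧ τ t₂ = μ ∧ {x ∈ W | F x μ = 0} = {s μ, y t₁, y t₂} ∧
    {x ∈ W | F x μ = 0}.ncard = 3

/-- The solutions of the Dziobek equations undergo at `(x, m)` a supercritical pitchfork in the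
direction `v` which breaks the symmetry `g`: the branch `s` has isotropy group `{e, g}`, and
the points of the branch `y` other than `x` have trivial isotropy and are interchanged by `g`.
All solutions nearby are planar configurations with the body `k` inside the triangle of the
other three. -/
def SymmetryBreakingPitchfork (g : D6) (k : Fin 4) (x : Vec) (m : ℝ) (v : Vec) : Prop :=
  ∃ (W : Set Vec) (ε δ : ℝ) (s : ℝ → Vec) (y : ℝ → Vec) (τ : ℝ → ℝ),
    IsSupercriticalPitchfork dziobek x m W ε δ s y τ ∧
    deriv y 0 = v ∧
    (∀ μ ∈ Set.Ioo (m - ε) (m + ε), isotropy (s μ) = {D6.e, g}) ∧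
    (∀ t ∈ Set.Ioo (-δ) δ, t ≠ 0 → isotropy (y t) = {D6.e}) ∧
    (∀ t ∈ Set.Ioo (-δ) δ, Phi g (y t) = y (-t) ∧ τ (-t) = τ t) ∧
    (∀ μ ∈ Set.Ioo (m - ε) (m + ε), ∀ z ∈ W, dziobek z μ = 0 → BodyInside k z)

theorem dziobek_zero (x : Vec) (m : ℝ) (hm : 3 + m ≠ 0) :
    dziobek x m 0 = (3 + m) * partialDeriv (lagrangian m) 0 x := by
  have h : (fun t => lagrangian m (Function.update x 0 t)) =
      fun t => t * (inertia m x - 1) + (potential m x + x 1 * cmDet x) := by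
    funext t
    simp [lagrangian, potential, inertia, cmDet, cayleyMenger,
      show Finset.Ici (2 : Fin 8) = {2, 3, 4, 5, 6, 7} by decide]
    ring
  simp only [partialDeriv, h]
  rw [((hasDerivAt_id' (x 0)).mul_const (inertia m x - 1)).add_const _ |>.deriv]
  simp only [dziobek, inertia, if_true]
  field_simp

theorem dziobek_one (x : Vec) (m : ℝ) :
    dziobek x m 1 = partialDeriv (lagrangian m) 1 x := by
  have h : (fun t => lagrangian m (Function.update x 1 t)) =
      fun t => t * cmDet x + (potential m x + x 0 * (inertia m x - 1)) := by
    funext t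
    simp [lagrangian, potential, inertia, cmDet, cayleyMenger,
      show Finset.Ici (2 : Fin 8) = {2, 3, 4, 5, 6, 7} by decide]
    ring
  simp only [partialDeriv, h]
  rw [((hasDerivAt_id' (x 1)).mul_const (cmDet x)).add_const _ |>.deriv]
  simp [dziobek]

theorem dziobek_dist (x : Vec) (m : ℝ) (hm : 3 + m ≠ 0) (k : Fin 8) (hk : 2 ≤ k)
    (hx : x k ≠ 0) :
    dziobek x m k = (3 + m) * x k ^ 2 * partialDeriv (lagrangian m) k x := by
  have h0 : k ≠ 0 := by rintro rfl; exact absurd hk (by decide)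
  have h1 : k ≠ 1 := by rintro rfl; exact absurd hk (by decide)
  have hk' : k ∈ Finset.Ici (2 : Fin 8) := by simpa using hk
  have hS : DifferentiableAt ℝ (fun t => cmDet (Function.update x k t)) (x k) := by
    have hc : ∀ l, Differentiable ℝ (fun t => Function.update x k t l) := fun l => by
      by_cases hl : l = k
      · subst hl; simp
      · simp [Function.update_of_ne hl]
    have h : ∀ i j, Differentiable ℝ (fun t => cayleyMenger (Function.update x k t) i j) := by
      intro i j
      fin_cases i <;> fin_cases j <;> simp [cayleyMenger] <;> exact (hc _).pow 2
    simp only [cmDet, Matrix.det_apply']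
    exact DifferentiableAt.fun_sum fun σ _ => DifferentiableAt.const_mul
      (DifferentiableAt.fun_finsetProd fun i _ => (h (σ i) i).differentiableAt) _
  have h : (fun t => lagrangian m (Function.update x k t)) =ᶠ[nhds (x k)]
      fun t => pairMass m k * t⁻¹ + x 0 / (3 + m) * pairMass m k * t ^ 2
        + x 1 * cmDet (Function.update x k t)
        + (∑ l ∈ (Finset.Ici (2 : Fin 8)).erase k, pairMass m l / x l + x 0 *
          ((∑ l ∈ (Finset.Ici (2 : Fin 8)).erase k, pairMass m l * x l ^ 2) / (3 + m) - 1)) := by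
    refine Filter.Eventually.of_forall fun t => ?_
    have e1 : ∑ l ∈ (Finset.Ici (2 : Fin 8)).erase k, pairMass m l / Function.update x k t l =
        ∑ l ∈ (Finset.Ici (2 : Fin 8)).erase k, pairMass m l / x l :=
      Finset.sum_congr rfl fun l hl => by rw [Function.update_of_ne (Finset.ne_of_mem_erase hl)]
    have e2 : ∑ l ∈ (Finset.Ici (2 : Fin 8)).erase k, pairMass m l * Function.update x k t l ^ 2 =
        ∑ l ∈ (Finset.Ici (2 : Fin 8)).erase k, pairMass m l * x l ^ 2 :=
      Finset.sum_congr rfl fun l hl => by rw [Function.update_of_ne (Finset.ne_of_mem_erase hl)]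
    simp only [lagrangian, potential, inertia]
    rw [← Finset.add_sum_erase _ _ hk', ← Finset.add_sum_erase _ _ hk', e1, e2,
      Function.update_self, Function.update_of_ne h0.symm, Function.update_of_ne h1.symm]
    ring
  have hd : HasDerivAt (fun t => lagrangian m (Function.update x k t))
      (pairMass m k * (-(x k ^ 2)⁻¹) + x 0 / (3 + m) * pairMass m k * (2 * x k)
        + x 1 * partialDeriv cmDet k x) (x k) := by
    refine HasDerivAt.congr_of_eventuallyEq ?_ h
    refine HasDerivAt.add_const _ (((hasDerivAt_inv hx).const_mul _).add ?_ |>.add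
      (hS.hasDerivAt.const_mul _))
    simpa using (hasDerivAt_pow 2 (x k)).const_mul (x 0 / (3 + m) * pairMass m k)
  have hp : partialDeriv (lagrangian m) k x = _ := hd.deriv
  rw [hp]
  simp only [dziobek, if_neg h0, if_neg h1]
  field_simp

end FourBody

end

/-!
The pitchfork breaks the reflection that exchanges the bodies 1 and 2. Write the unknowns as
`x₃, x₅ = a ∓ α` and `x₄, x₆ = b ∓ t`. The antisymmetric components of the Dziobek map are linear in
`(α, t)` with even coefficients, and the bifurcating branch leaves the symmetric one with
`(α, t) ∥ (β, 1)`. After the blow-up `α = β t`, `T = t ^ 2` and division by `t`, the bifurcating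
branch is the zero set of a polynomial system of eight equations in the nine unknowns
`(λ₀, μ, c, a, b, d, β, m, T)`, which is regular at `T = 0`.

Rational interval arithmetic encloses the Jacobian matrix of this system, and an approximate inverse
shows that the zeros are parametrized by `T`, that there is exactly one of them over `T = 0`, which
is the bifurcation point, and that `dm/dT ≈ 24 > 0` along them, which makes the pitchfork
supercritical. The symmetric branch comes from the block of the same Jacobian that belongs to the
symmetric components. Along the line through the bifurcation point in the direction `v` the function
`wᵀF` is odd, and its third derivative is read off the reduced system as well. The other two
configurations are obtained by relabelling the bodies.
-/

open scoped Matrix Topology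

namespace FourBody

/-! ## Interval arithmetic for polynomials -/

/-- Polynomial expressions with rational coefficients in variables indexed by `σ`. Unlike
`MvPolynomial` they can be differentiated and enclosed by kernel computation. -/
inductive PolyExpr (σ : Type*) : Type _
  | const (q : ℚ)
  | var (i : σ)
  | add (a b : PolyExpr σ)
  | mul (a b : PolyExpr σ)

namespace PolyExpr

variable {σ : Type*}

instance : Add (PolyExpr σ) := ⟨add⟩
instance : Mul (PolyExpr σ) := ⟨mul⟩
instance : Neg (PolyExpr σ) := ⟨fun a => mul (const (-1)) a⟩
instance : Sub (PolyExpr σ) := ⟨fun a b => a + -b⟩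
instance (k : ℕ) : OfNat (PolyExpr σ) k := ⟨const k⟩

/-- Powers with a natural exponent. -/
def pow (a : PolyExpr σ) : ℕ → PolyExpr σ
  | 0 => const 1
  | 1 => a
  | k + 2 => mul (pow a (k + 1)) a

instance : HPow (PolyExpr σ) ℕ (PolyExpr σ) := ⟨pow⟩

/-- The value of an expression at a real point. -/
noncomputable def eval (x : σ → ℝ) : PolyExpr σ → ℝ
  | const q => q
  | var i => x i
  | add a b => eval x a + eval x b
  | mul a b => eval x a * eval x b

/-- The formal partial derivative in the variable `i`. -/
def pderiv [DecidableEq σ] (i : σ) : PolyExpr σ → PolyExpr σ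
  | const _ => const 0
  | var j => const (if j = i then 1 else 0)
  | add a b => add (pderiv i a) (pderiv i b)
  | mul a b => add (mul (pderiv i a) b) (mul a (pderiv i b))

/-- Midpoint and radius of an interval that contains all values of the expression on the box
with centre `c` and radii `r`. -/
def ball (c r : σ → ℚ) : PolyExpr σ → ℚ × ℚ
  | const q => (q, 0)
  | var i => (c i, r i)
  | add a b => (ball c r a + ball c r b)
  | mul a b =>
      let x := ball c r a
      let y := ball c r b
      (x.1 * y.1, |x.1| * y.2 + x.2 * |y.1| + x.2 * y.2)

section Eval

variable (x : σ → ℝ)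

@[simp] theorem eval_const (q : ℚ) : eval x (const q) = q := rfl
@[simp] theorem eval_var (i : σ) : eval x (var i) = x i := rfl
@[simp] theorem eval_add (a b : PolyExpr σ) : eval x (a + b) = eval x a + eval x b := rfl
@[simp] theorem eval_mul (a b : PolyExpr σ) : eval x (a * b) = eval x a * eval x b := rfl

@[simp] theorem eval_neg (a : PolyExpr σ) : eval x (-a) = -eval x a := by
  change ((-1 : ℚ) : ℝ) * eval x a = _
  push_cast; ring

@[simp] theorem eval_sub (a b : PolyExpr σ) : eval x (a - b) = eval x a - eval x b := by
  change eval x (a + -b) = _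
  rw [eval_add, eval_neg, sub_eq_add_neg]

@[simp] theorem eval_ofNat (k : ℕ) [k.AtLeastTwo] :
    eval x (ofNat(k) : PolyExpr σ) = ofNat(k) := by
  change (((k : ℕ) : ℚ) : ℝ) = _
  push_cast; rfl

@[simp] theorem eval_pow (a : PolyExpr σ) : ∀ k : ℕ, eval x (a ^ k) = eval x a ^ k
  | 0 => by change ((1 : ℚ) : ℝ) = _; simp
  | 1 => (pow_one _).symm
  | k + 2 => by
    rw [pow_succ, ← eval_pow a (k + 1)]
    rfl

end Eval

theorem contDiff_eval [Fintype σ] (e : PolyExpr σ) : ContDiff ℝ ω (fun x => eval x e) := by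
  induction e with
  | const q => exact contDiff_const
  | var i => exact contDiff_apply ℝ ℝ i
  | add a b ha hb => exact ha.add hb
  | mul a b ha hb => exact ha.mul hb

section PDeriv

variable [DecidableEq σ]

theorem hasFDerivAt_eval [Fintype σ] (e : PolyExpr σ) (x : σ → ℝ) :
    HasFDerivAt (fun x => eval x e)
      (∑ i, eval x (pderiv i e) • ContinuousLinearMap.proj (R := ℝ) (φ := fun _ : σ => ℝ) i) x := by
  induction e with
  | const q => simpa [eval, pderiv] using hasFDerivAt_const (q : ℝ) x
  | var i => simpa [eval, pderiv, apply_ite, ite_smul] using hasFDerivAt_apply i x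
  | add a b ha hb =>
    simp only [pderiv, eval, add_smul, Finset.sum_add_distrib]
    exact ha.add hb
  | mul a b ha hb =>
    refine (ha.mul hb).congr_fderiv ?_
    simp only [pderiv, eval, add_smul, mul_smul, Finset.sum_add_distrib, Finset.smul_sum,
      smul_comm (eval x b)]
    exact add_comm _ _

theorem hasDerivAt_eval_update [Finite σ] (e : PolyExpr σ) (x : σ → ℝ) (k : σ) (t : ℝ) :
    HasDerivAt (fun t => eval (Function.update x k t) e)
      (eval (Function.update x k t) (pderiv k e)) t := by
  have := Fintype.ofFinite σ
  simpa [Pi.single_apply, Function.comp_def] using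
    (hasFDerivAt_eval e _).comp_hasDerivAt t (hasDerivAt_update x k t)

section

variable (x : σ → ℝ) (i : σ)

@[simp] theorem eval_pderiv_var (j : σ) :
    eval x (pderiv i (var j)) = if j = i then 1 else 0 := by
  simp [pderiv, apply_ite]

@[simp] theorem eval_pderiv_add (a b : PolyExpr σ) :
    eval x (pderiv i (a + b)) = eval x (pderiv i a) + eval x (pderiv i b) := rfl

@[simp] theorem eval_pderiv_mul (a b : PolyExpr σ) :
    eval x (pderiv i (a * b)) = eval x (pderiv i a) * eval x b + eval x a * eval x (pderiv i b) :=
  rfl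

@[simp] theorem eval_pderiv_sub (a b : PolyExpr σ) :
    eval x (pderiv i (a - b)) = eval x (pderiv i a) - eval x (pderiv i b) := by
  change eval x (pderiv i a) + (((0 : ℚ) : ℝ) * eval x b + ((-1 : ℚ) : ℝ) * eval x (pderiv i b)) = _
  push_cast; ring

@[simp] theorem eval_pderiv_ofNat (k : ℕ) [k.AtLeastTwo] :
    eval x (pderiv i (ofNat(k) : PolyExpr σ)) = 0 := by
  change ((0 : ℚ) : ℝ) = 0
  simp

@[simp] theorem eval_pderiv_sq (a : PolyExpr σ) :
    eval x (pderiv i (a ^ 2)) = 2 * eval x a * eval x (pderiv i a) := by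
  change eval x (pderiv i a) * eval x a + eval x a * eval x (pderiv i a) = _
  ring

end

theorem exists_eval_sub_eq [Fintype σ] (e : PolyExpr σ) (x y : σ → ℝ) :
    ∃ ξ ∈ segment ℝ y x, eval x e - eval y e = ∑ i, eval ξ (pderiv i e) * (x i - y i) := by
  obtain ⟨ξ, hξ, h⟩ := domain_mvt (fun z _ => (hasFDerivAt_eval e z).hasFDerivWithinAt)
    convex_univ (Set.mem_univ y) (Set.mem_univ x)
  exact ⟨ξ, hξ, by simpa using h⟩

end PDeriv

theorem abs_eval_sub_ball_le {c r : σ → ℚ} {x : σ → ℝ} (h : ∀ i, |x i - c i| ≤ r i)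
    (e : PolyExpr σ) : |eval x e - (ball c r e).1| ≤ (ball c r e).2 := by
  induction e with
  | const q => simp [ball]
  | var i => exact h i
  | add a b ha hb =>
    simp only [ball, eval, Prod.fst_add, Prod.snd_add, Rat.cast_add, add_sub_add_comm]
    exact (abs_add_le _ _).trans (add_le_add ha hb)
  | mul a b ha hb =>
    simp only [ball, eval]
    push_cast
    set p := (((ball c r a).1 : ℚ) : ℝ)
    set q := (((ball c r b).1 : ℚ) : ℝ)
    calc _ = |p * (eval x b - q) + (eval x a - p) * q + (eval x a - p) * (eval x b - q)| := by
          ring_nf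
      _ ≤ |p * (eval x b - q)| + |(eval x a - p) * q| + |(eval x a - p) * (eval x b - q)| :=
          abs_add_three _ _ _
      _ ≤ _ := by
          simp only [abs_mul]
          have := (abs_nonneg (eval x a - p)).trans ha
          gcongr

theorem abs_eval_sub_le_of_ball {c r : σ → ℚ} {x : σ → ℝ} {e : PolyExpr σ} {q η : ℚ}
    (hb : |(ball c r e).1 - q| + (ball c r e).2 ≤ η) (hx : ∀ i, |x i - c i| ≤ r i) :
    |eval x e - q| ≤ η := by
  have hb' : |((ball c r e).1 - q : ℝ)| + (ball c r e).2 ≤ η := by exact_mod_cast hb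
  linarith [abs_sub_le (eval x e) (ball c r e).1 q, abs_eval_sub_ball_le hx e]

end PolyExpr

open PolyExpr

section Newton

/-- The simplified Newton method: `x ↦ x - g x` is a contraction of the closed ball. -/
theorem exists_mem_closedBall_eq_zero {E : Type*} [NormedAddCommGroup E] [CompleteSpace E]
    {g : E → E} {c : E} {R : ℝ} {q : NNReal} (hq : q < 1)
    (hg : ∀ x ∈ Metric.closedBall c R, ∀ y ∈ Metric.closedBall c R,
      ‖(x - y) - (g x - g y)‖ ≤ q * ‖x - y‖)
    (hc : ‖g c‖ ≤ (1 - q) * R) : ∃ x ∈ Metric.closedBall c R, g x = 0 := by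
  have hq' : (0 : ℝ) < 1 - q := sub_pos.2 (by exact_mod_cast hq)
  have hR : 0 ≤ R := nonneg_of_mul_nonneg_right ((norm_nonneg _).trans hc) hq'
  have hcR : c ∈ Metric.closedBall c R := Metric.mem_closedBall_self hR
  set newton : E → E := fun x => x - g x with hnewton
  have hdist : ∀ x ∈ Metric.closedBall c R, ∀ y ∈ Metric.closedBall c R,
      dist (newton x) (newton y) ≤ q * dist x y := by
    intro x hx y hy
    rw [dist_eq_norm, dist_eq_norm, hnewton, sub_sub_sub_comm]
    exact hg x hx y hy
  have hmaps : Set.MapsTo newton (Metric.closedBall c R) (Metric.closedBall c R) := by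
    intro x hx
    have hqx : q * dist x c ≤ q * R := mul_le_mul_of_nonneg_left hx q.2
    have hgc : dist (newton c) c ≤ (1 - q) * R := by
      rwa [dist_eq_norm, hnewton, sub_sub_cancel_left, norm_neg]
    rw [Metric.mem_closedBall]
    linarith [dist_triangle (newton x) (newton c) c, hdist x hx c hcR]
  have hcontr : ContractingWith q hmaps.restrict :=
    ⟨hq, LipschitzWith.of_dist_le_mul fun x y => hdist x x.2 y y.2⟩
  obtain ⟨x, hx, hfix, -⟩ := hcontr.exists_fixedPoint'
    Metric.isClosed_closedBall.isComplete hmaps hcR (edist_ne_top _ _)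
  exact ⟨x, hx, sub_eq_self.1 hfix⟩

end Newton

section ApproxInverse

variable {ι : Type*} [Fintype ι] [DecidableEq ι]

/-- A computable certificate that the rational matrix `P` is an approximate inverse of every real
matrix that differs from `A` by at most `η` in each entry, with relative error `q` in the supremum
norm. -/
def IsApproxInverse (P A : Matrix ι ι ℚ) (η q : ℚ) : Prop :=
  ∀ i, ∑ j, (|(1 - P * A) i j| + η * ∑ k, |P i k|) ≤ q

namespace IsApproxInverse

variable {P A : Matrix ι ι ℚ} {η q : ℚ}

theorem norm_sub_mulVec_le (h : IsApproxInverse P A η q) {J : Matrix ι ι ℝ}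
    (hJ : ∀ i j, |J i j - A i j| ≤ η) (u : ι → ℝ) :
    ‖u - P.map (Rat.cast : ℚ → ℝ) *ᵥ (J *ᵥ u)‖ ≤ q * ‖u‖ := by
  cases isEmpty_or_nonempty ι
  · simp [Subsingleton.elim u 0]
  refine (pi_norm_le_iff_of_nonempty _).2 fun i => ?_
  have hentry : ∀ j, |(1 - P.map (Rat.cast : ℚ → ℝ) * J) i j| ≤
      |((1 - P * A) i j : ℚ)| + η * ∑ k, |(P i k : ℝ)| := by
    intro j
    have hsplit : (1 - P.map (Rat.cast : ℚ → ℝ) * J) i j =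
        (1 - P * A) i j - ∑ k, (P i k : ℝ) * (J k j - A k j) := by
      simp only [Matrix.sub_apply, Matrix.mul_apply, Matrix.map_apply, Matrix.one_apply, mul_sub,
        Finset.sum_sub_distrib]
      split_ifs <;> push_cast <;> ring
    rw [hsplit, Finset.mul_sum, Rat.cast_abs]
    refine (abs_sub _ _).trans (add_le_add le_rfl ((Finset.abs_sum_le_sum_abs _ _).trans
      (Finset.sum_le_sum fun k _ => ?_)))
    rw [abs_mul, mul_comm]
    exact mul_le_mul_of_nonneg_right (hJ k j) (abs_nonneg _)
  have hrow : ∑ j, |(1 - P.map (Rat.cast : ℚ → ℝ) * J) i j| ≤ q := by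
    refine (Finset.sum_le_sum fun j _ => hentry j).trans ?_
    exact_mod_cast h i
  calc ‖(u - P.map (Rat.cast : ℚ → ℝ) *ᵥ (J *ᵥ u)) i‖
      = |∑ j, (1 - P.map (Rat.cast : ℚ → ℝ) * J) i j * u j| := by
        rw [Matrix.mulVec_mulVec, Real.norm_eq_abs]
        nth_rw 1 [← Matrix.one_mulVec u]
        rw [← Matrix.sub_mulVec]
        rfl
    _ ≤ ∑ j, |(1 - P.map (Rat.cast : ℚ → ℝ) * J) i j| * ‖u‖ := by
        refine (Finset.abs_sum_le_sum_abs _ _).trans (Finset.sum_le_sum fun j _ => ?_)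
        rw [abs_mul]
        exact mul_le_mul_of_nonneg_left (norm_le_pi_norm u j) (abs_nonneg _)
    _ ≤ q * ‖u‖ := by
        rw [← Finset.sum_mul]
        exact mul_le_mul_of_nonneg_right hrow (norm_nonneg u)

theorem eq_zero_of_mulVec_eq_zero (h : IsApproxInverse P A η q) (hq : q < 1) {J : Matrix ι ι ℝ}
    (hJ : ∀ i j, |J i j - A i j| ≤ η) {u : ι → ℝ} (hu : J *ᵥ u = 0) : u = 0 := by
  have hle := h.norm_sub_mulVec_le hJ u
  rw [hu, Matrix.mulVec_zero, sub_zero] at hle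
  have hq' : (q : ℝ) < 1 := by exact_mod_cast hq
  exact norm_le_zero_iff.1 (by nlinarith [norm_nonneg u])

theorem mulVec_eq_zero_iff (h : IsApproxInverse P A η q) (hη : 0 ≤ η) (hq : q < 1) {u : ι → ℝ} :
    P.map (Rat.cast : ℚ → ℝ) *ᵥ u = 0 ↔ u = 0 := by
  refine ⟨fun hu => ?_, fun hu => by rw [hu, Matrix.mulVec_zero]⟩
  set Q := P.map (Rat.cast : ℚ → ℝ)
  set B := A.map (Rat.cast : ℚ → ℝ)
  have hB : ∀ i j, |B i j - A i j| ≤ η := fun i j => by simpa [B] using hη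
  have hdet : (Q * B).det ≠ 0 := by
    intro h0
    obtain ⟨v, hv, hv'⟩ := Matrix.exists_mulVec_eq_zero_iff.2 h0
    have hle := h.norm_sub_mulVec_le hB v
    rw [Matrix.mulVec_mulVec, hv', sub_zero] at hle
    have hq' : (q : ℝ) < 1 := by exact_mod_cast hq
    exact hv (norm_le_zero_iff.1 (by nlinarith [norm_nonneg v]))
  by_contra hu'
  rw [Matrix.det_mul, Matrix.exists_mulVec_eq_zero_iff.1 ⟨u, hu', hu⟩, zero_mul] at hdet
  exact hdet rfl

end IsApproxInverse

end ApproxInverse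

section PolySystem

variable {ι : Type*}

/-- The map `ℝ^ι → ℝ^ι` with polynomial components `e`. -/
noncomputable def polyMap (e : ι → PolyExpr ι) (x : ι → ℝ) : ι → ℝ := fun i => eval x (e i)

/-- The Jacobian matrix of `polyMap e`. -/
noncomputable def polyJac [DecidableEq ι] (e : ι → PolyExpr ι) (x : ι → ℝ) : Matrix ι ι ℝ :=
  Matrix.of fun i j => eval x (pderiv j (e i))

variable [Fintype ι]

theorem contDiff_polyMap (e : ι → PolyExpr ι) : ContDiff ℝ ω (polyMap e) :=
  contDiff_pi.2 fun i => contDiff_eval (e i)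

variable [DecidableEq ι]

theorem hasFDerivAt_polyMap (e : ι → PolyExpr ι) (x : ι → ℝ) :
    HasFDerivAt (polyMap e) (polyJac e x).mulVecLin.toContinuousLinearMap x := by
  refine hasFDerivAt_pi'.2 fun i => ?_
  refine (hasFDerivAt_eval (e i) x).congr_fderiv ?_
  ext u
  simp [polyJac, Matrix.mulVec, dotProduct]

theorem exists_polyMap_sub_eq {e : ι → PolyExpr ι} {A : Matrix ι ι ℚ} {η : ℚ} {s : Set (ι → ℝ)}
    (hs : Convex ℝ s) (hA : ∀ x ∈ s, ∀ i j, |polyJac e x i j - A i j| ≤ η) {x y : ι → ℝ}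
    (hx : x ∈ s) (hy : y ∈ s) :
    ∃ J : Matrix ι ι ℝ, (∀ i j, |J i j - A i j| ≤ η) ∧
      polyMap e x - polyMap e y = J *ᵥ (x - y) := by
  choose ξ hξ h using fun i => exists_eval_sub_eq (e i) x y
  exact ⟨Matrix.of fun i j => polyJac e (ξ i) i j,
    fun i => hA (ξ i) (hs.segment_subset hy hx (hξ i)) i, funext h⟩

end PolySystem

section Parity

variable {F : Type*} [NormedAddCommGroup F] [NormedSpace ℝ F]

theorem iteratedDeriv_zero_of_odd {f : ℝ → F} (hf : Function.Odd f) {n : ℕ} (hn : Even n) :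
    iteratedDeriv n f 0 = 0 := by
  have h := iteratedDeriv_comp_neg n f 0
  rw [funext hf, iteratedDeriv_fun_neg, neg_zero, hn.neg_one_pow, one_smul] at h
  have : IsAddTorsionFree F := .of_isTorsionFree ℝ F
  exact self_eq_neg.1 h.symm

theorem deriv_deriv_comp_sq {f : ℝ → F} (hf : ContDiffAt ℝ 2 f 0) :
    deriv (deriv fun t : ℝ => f (t ^ 2)) 0 = (2 : ℝ) • deriv f 0 := by
  have hsq : ContinuousAt (fun t : ℝ => t ^ 2) 0 := by fun_prop
  have hsq_zero : (0 : ℝ) ^ 2 = 0 := by norm_num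
  have hdiff : ∀ᶠ s in 𝓝 (0 : ℝ), DifferentiableAt ℝ f s :=
    (hf.eventually (by simp)).mono fun s hs => hs.differentiableAt (by simp)
  have hderiv : deriv (fun t : ℝ => f (t ^ 2)) =ᶠ[𝓝 0] fun t => (2 * t) • deriv f (t ^ 2) := by
    filter_upwards [hsq.eventually (hsq_zero.symm ▸ hdiff)] with t ht
    simpa [Function.comp_def] using
      (ht.hasDerivAt.scomp (h := fun t : ℝ => t ^ 2) t (hasDerivAt_pow 2 t)).deriv
  have hcomp : DifferentiableAt ℝ (fun t : ℝ => deriv f (t ^ 2)) 0 := by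
    refine DifferentiableAt.comp (g := deriv f) (f := fun t : ℝ => t ^ 2) 0 ?_ (by fun_prop)
    rw [hsq_zero]
    exact ((hf.fderiv_right (m := 1) (by norm_num)).differentiableAt (by simp)).clm_apply
      (differentiableAt_const (1 : ℝ))
  rw [hderiv.deriv_eq]
  simpa using (((hasDerivAt_id (0 : ℝ)).const_mul 2).fun_smul hcomp.hasDerivAt).deriv

theorem iteratedDeriv_three_mul_comp_sq {f : ℝ → ℝ} (hf : ContDiffAt ℝ 3 f 0) :
    iteratedDeriv 3 (fun t => t * f (t ^ 2)) 0 = 6 * deriv f 0 := by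
  have hsq : ContDiffAt ℝ 3 (fun t : ℝ => f (t ^ 2)) 0 :=
    ContDiffAt.comp (0 : ℝ) (by simpa using hf) (by fun_prop)
  have hleibniz := iteratedDeriv_mul (f := fun t : ℝ => t) contDiffAt_id hsq
  have htwo : iteratedDeriv 2 (fun t : ℝ => f (t ^ 2)) 0 = 2 * deriv f 0 := by
    rw [iteratedDeriv_succ, iteratedDeriv_one, deriv_deriv_comp_sq (hf.of_le (by norm_num)),
      smul_eq_mul]
  refine hleibniz.trans ?_
  simp [iteratedDeriv_fun_id_zero, htwo]
  ring

theorem map_iteratedFDeriv_const {E G : Type*} [NormedAddCommGroup E] [NormedSpace ℝ E]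
    [NormedAddCommGroup G] [NormedSpace ℝ G] {f : E → F} (L : F →L[ℝ] G) {n : ℕ}
    (hf : ContDiff ℝ n f) (x v : E) :
    L (iteratedFDeriv ℝ n f x fun _ => v) = iteratedDeriv n (fun t : ℝ => L (f (x + t • v))) 0 := by
  set g : ℝ →L[ℝ] E := ContinuousLinearMap.toSpanSingleton ℝ v
  have hshift : ContDiff ℝ n (fun z => f (x + z)) := hf.comp (contDiff_const.add contDiff_id)
  have hcomp : (fun t : ℝ => L (f (x + t • v))) = L ∘ ((fun z => f (x + z)) ∘ g) := rfl
  rw [hcomp, iteratedDeriv_eq_iteratedFDeriv,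
    L.iteratedFDeriv_comp_left (hshift.comp g.contDiff).contDiffAt le_rfl,
    g.iteratedFDeriv_comp_right hshift 0 le_rfl]
  simp [iteratedFDeriv_comp_add_left, g]

end Parity

theorem ker_transpose_mulVecLin_eq_span {K ι : Type*} [Field K] [Fintype ι]
    {A : Matrix ι ι K} {v w : ι → K} (hA : LinearMap.ker A.mulVecLin = Submodule.span K {v})
    (hv : v ≠ 0) (hAw : Aᵀ *ᵥ w = 0) (hw : w ≠ 0) :
    LinearMap.ker Aᵀ.mulVecLin = Submodule.span K {w} := by
  classical
  have hle := (Submodule.span_singleton_le_iff_mem w (LinearMap.ker Aᵀ.mulVecLin)).2 hAw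
  refine (Submodule.eq_of_le_of_finrank_eq hle ?_).symm
  have hker := A.mulVecLin.finrank_range_add_finrank_ker
  have hcoker := Aᵀ.mulVecLin.finrank_range_add_finrank_ker
  have hrank : Aᵀ.rank = A.rank := A.rank_transpose
  rw [hA, finrank_span_singleton hv] at hker
  rw [finrank_span_singleton hw]
  unfold Matrix.rank at hrank
  omega

local notation "X" => PolyExpr.var (σ := Fin 9)

/-! ## The reduced system -/

section Reduced

variable (p q r : PolyExpr (Fin 9))

/-!
Write `x₃, x₅ = a ∓ α` and `x₄, x₆ = b ∓ t`. The components of the Dziobek map that are symmetric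
under the exchange of the bodies 1 and 2 are polynomials in `p = α²`, `q = α t`, `r = t²`, and the
antisymmetric ones are linear combinations of `α` and `t` with coefficients of this form.
The variables `0, …, 5` and `7` stand for `λ₀, μ, c, a, b, d` and `m`.
-/

/-- Mean of the squares of `a ± α`. -/
def sqA : PolyExpr (Fin 9) := X 3 ^ 2 + p

/-- Mean of the squares of `b ± t`. -/
def sqB : PolyExpr (Fin 9) := X 4 ^ 2 + r

/-- Total mass. -/
def totalMass : PolyExpr (Fin 9) := 3 + X 7

/-- The Cayley-Menger determinant. -/
def cmEven : PolyExpr (Fin 9) :=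
  X 2 ^ 2 * (-2 * X 2 ^ 2 * X 5 ^ 2 - 2 * sqA p ^ 2 + 4 * sqA p * sqB r
    + 4 * sqA p * X 5 ^ 2 + 8 * X 3 ^ 2 * p - 16 * X 3 * X 4 * q - 2 * sqB r ^ 2
    + 4 * sqB r * X 5 ^ 2 + 8 * X 4 ^ 2 * r - 2 * X 5 ^ 4)
  + 32 * X 3 * X 4 * q * (sqA p + sqB r - X 5 ^ 2) - 32 * sqA p * X 4 ^ 2 * r
  - 32 * X 3 ^ 2 * p * sqB r

/-- Derivative of the Cayley-Menger determinant in `c²`. -/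
def cmC : PolyExpr (Fin 9) :=
  -4 * X 2 ^ 2 * X 5 ^ 2 - 2 * sqA p ^ 2 + 4 * sqA p * sqB r + 4 * sqA p * X 5 ^ 2
    + 8 * X 3 ^ 2 * p - 16 * X 3 * X 4 * q - 2 * sqB r ^ 2 + 4 * sqB r * X 5 ^ 2
    + 8 * X 4 ^ 2 * r - 2 * X 5 ^ 4

/-- Derivative of the Cayley-Menger determinant in `d²`. -/
def cmD : PolyExpr (Fin 9) :=
  X 2 ^ 2 * (-2 * X 2 ^ 2 + 4 * sqA p + 4 * sqB r - 4 * X 5 ^ 2) - 32 * X 3 * X 4 * q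

/-- Symmetric part of the derivative of the Cayley-Menger determinant in `(a + α)²`. -/
def cmA : PolyExpr (Fin 9) :=
  2 * X 2 ^ 2 * (sqB r + X 5 ^ 2 - sqA p) + 16 * X 3 * X 4 * q - 16 * X 4 ^ 2 * r

/-- Symmetric part of the derivative of the Cayley-Menger determinant in `(b + t)²`. -/
def cmB : PolyExpr (Fin 9) :=
  2 * X 2 ^ 2 * (sqA p + X 5 ^ 2 - sqB r) + 16 * X 3 * X 4 * q - 16 * X 3 ^ 2 * p

/-- The antisymmetric parts of the derivatives of the Cayley-Menger determinant in `(a + α)²` and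
`(b + t)²` are `2 (a α cmAA + b t cmAB)` and `2 (a α cmAB + b t cmBB)`. -/
def cmAA : PolyExpr (Fin 9) := 2 * X 2 ^ 2 - 8 * sqB r

/-- See `cmAA`. -/
def cmAB : PolyExpr (Fin 9) := 4 * sqA p + 4 * sqB r - 4 * X 5 ^ 2 - 2 * X 2 ^ 2

/-- See `cmAA`. -/
def cmBB : PolyExpr (Fin 9) := 2 * X 2 ^ 2 - 8 * sqA p

/-- Symmetric part of `(a + α)³`. -/
def cubeA : PolyExpr (Fin 9) := X 3 ^ 3 + 3 * X 3 * p

/-- Antisymmetric part of `(a + α)³`, divided by `α`. -/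
def cubeA' : PolyExpr (Fin 9) := 3 * X 3 ^ 2 + p

/-- Symmetric part of `(b + t)³`. -/
def cubeB : PolyExpr (Fin 9) := X 4 ^ 3 + 3 * X 4 * r

/-- Antisymmetric part of `(b + t)³`, divided by `t`. -/
def cubeB' : PolyExpr (Fin 9) := 3 * X 4 ^ 2 + r

/-- The symmetric components of the Dziobek map. -/
def even : Fin 6 → PolyExpr (Fin 9) := ![
  X 2 ^ 2 + 2 * sqA p + 2 * X 7 * sqB r + X 7 * X 5 ^ 2 - totalMass,
  cmEven p q r,
  -totalMass + 2 * X 2 ^ 3 * (X 0 + X 1 * totalMass * cmC p q r),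
  -totalMass + 2 * X 0 * cubeA p + 2 * X 1 * totalMass * (cubeA p * cmA p q r
    + 2 * cubeA' p * (X 3 * p * cmAA r + X 4 * q * cmAB p r)),
  -totalMass * X 7 + 2 * X 0 * X 7 * cubeB r + 2 * X 1 * totalMass * (cubeB r * cmB p q r
    + 2 * cubeB' r * (X 3 * q * cmAB p r + X 4 * r * cmBB p)),
  -totalMass * X 7 + 2 * X 5 ^ 3 * (X 0 * X 7 + X 1 * totalMass * cmD p q r)]

/-- Coefficients of the antisymmetric components: `(F₅ - F₃) / 2 = oddAA * α + oddAB * t` and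
`(F₆ - F₄) / 2 = oddBA * α + oddBB * t`. -/
def oddAA : PolyExpr (Fin 9) :=
  2 * X 0 * cubeA' p
    + 2 * X 1 * totalMass * (2 * X 3 * cubeA p * cmAA r + cubeA' p * cmA p q r)

/-- See `oddAA`. -/
def oddAB : PolyExpr (Fin 9) := 4 * X 1 * totalMass * X 4 * cubeA p * cmAB p r

/-- See `oddAA`. -/
def oddBA : PolyExpr (Fin 9) := 4 * X 1 * totalMass * X 3 * cubeB r * cmAB p r

/-- See `oddAA`. -/
def oddBB : PolyExpr (Fin 9) :=
  2 * X 0 * X 7 * cubeB' r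
    + 2 * X 1 * totalMass * (2 * X 4 * cubeB r * cmBB p + cubeB' r * cmB p q r)

end Reduced

/-- The reduced system in the unknowns `(λ₀, μ, c, a, b, d, β, m, T)`, where `α = β t` and
`T = t²`: the symmetric components, the antisymmetric ones divided by `t`, and `T` itself, so
that prescribing `T` gives a square system. -/
def reduced : Fin 9 → PolyExpr (Fin 9) :=
  let p := X 8 * X 6 ^ 2
  let q := X 8 * X 6
  let r := X 8
  ![even p q r 0, even p q r 1, even p q r 2, even p q r 3, even p q r 4, even p q r 5,
    X 6 * oddAA p q r + oddAB p r, X 6 * oddBA p r + oddBB p q r, X 8]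

/-- Centre of the box in which the reduced system is studied. -/
def boxCenter : Fin 9 → ℚ :=
  ![4.0773330463636, 0.7771554002479, 1.0134749516061, 0.5762129952718, 0.9951533019209,
    0.5821772578754, -0.3481037459704, 0.9918422743909, 0]

/-- Radius of the box in which the reduced system is studied. -/
def boxRadius : ℚ := 1 / 10 ^ 9

/-- Approximate Jacobian matrix of the reduced system on the box. -/
def approxJac : Matrix (Fin 9) (Fin 9) ℚ :=
  !![0, 0, 2.0269, 2.3049, 3.9481, 1.1549, 0, 1.3196, 2.226;
    0, 0, -1.4113, 4.7217, -2.6116, 2.2477, 0, 0, -7.1457;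
    2.0819, -5.7864, -5.9323, 29.6908, -16.4224, -1.3149, 0, -2.1265, 68.748;
    0.3826, 3.129, 4.7988, 17.973, 4.8533, 2.8392, 0, -0.3908, -29.1982;
    1.955, -5.1622, -7.917, 14.4761, -13.0653, 14.6259, 0, 2.048, -58.4923;
    0.3914, 3.041, -0.4339, 5.7966, 10.0111, 14.5458, 0, -2.7826, 13.4595;
    -0.6935, 3.6383, -20.2052, 33.389, 22.0568, -16.1491, 12.7555, 0.7083, 58.5214;
    5.8935, -30.9202, 35.4149, -87.872, -114.2523, 55.5162, 13.244, 18.2077, -158.9564;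
    0, 0, 0, 0, 0, 0, 0, 0, 1]

/-- Accuracy of `approxJac`. -/
def jacError : ℚ := 1 / 10 ^ 4

/-- Approximate inverse of `approxJac`. -/
def approxInv : Matrix (Fin 9) (Fin 9) ℚ :=
  !![-1.53214, -3.00215, -0.23779, 0.78403, 0.70562, -0.22654, 0.01503, -0.01448, 62.33958;
    -0.6814, -0.31475, -0.18808, 0.33068, 0.18388, -0.13137, 0.00675, -0.00651, 32.94708;
    0.12694, 0.03565, 0.03826, 0.01117, -0.07178, 0.02195, -0.00751, 0.00723, -5.23813;
    0.07217, 0.10735, 0.02006, -0.00222, -0.01998, 0.002, 0.00041, -0.0004, -2.12102;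
    0.12465, -0.08549, 0.01608, -0.04019, -0.00773, 0.03205, 0.00244, -0.00235, -4.56625;
    0.07292, 0.14244, 0.00056, -0.03502, -0.01207, 0.04681, -0.00275, 0.00265, -0.95978;
    -0.00001, 0.03634, 0.02963, -0.01066, -0.08732, 0.0682, 0.05629, 0.02129, -8.02487;
    0.00001, -0.11116, -0.1424, 0.13763, 0.17885, -0.17406, 0.00592, -0.0057, 24.56531;
    0, 0, 0, 0, 0, 0, 0, 0, 1]

/-- Approximate inverse of the block of `approxJac` that belongs to symmetric configurations. -/
def approxInvSymm : Matrix (Fin 6) (Fin 6) ℚ :=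
  !![-1.53212, -2.72004, 0.12359, 0.43475, 0.25173, 0.21515;
    -0.6814, -0.18797, -0.02567, 0.1737, -0.02011, 0.06714;
    0.12694, -0.10523, -0.14219, 0.18559, 0.15487, -0.19862;
    0.07217, 0.11511, 0.03, -0.01183, -0.03246, 0.01414;
    0.12465, -0.03974, 0.07466, -0.09682, -0.08131, 0.10365;
    0.07292, 0.09083, -0.06554, 0.02887, 0.07095, -0.03398]

/-- Approximate zero of the reduced system. -/
def approxZero : Fin 9 → ℚ :=
  ![4.07733304636361696432719603508202,
    0.77715540024789459345221571833534,
    1.01347495160611012165127833256593,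
    0.57621299527180807511793645654536,
    0.99515330192094671865163367610487,
    0.58217725787535124807123864079827,
    -0.34810374597044168798328600809173,
    0.99184227439094091554349694436441,
    0]

/-- Centre of the box of the symmetric and antisymmetric parts `(λ₀, μ, c, a, b, d, α, m, t)` of the
configurations near the bifurcation. -/
def configCenter : Fin 9 → ℚ := Function.update boxCenter 6 0

/-- Radius of that box. -/
def configRadius : ℚ := 1 / 10 ^ 12

/-- The indices of the symmetric components of the reduced system, which are also the indices of
the unknowns that describe a symmetric configuration. -/
def symm : Fin 6 → Fin 9 := Fin.castLE (by decide)

theorem ball_pderiv_reduced (i j : Fin 9) :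
    |(ball boxCenter (fun _ => boxRadius) (pderiv j (reduced i))).1 - approxJac i j|
      + (ball boxCenter (fun _ => boxRadius) (pderiv j (reduced i))).2 ≤ jacError := by
  revert i j
  decide +kernel

theorem ball_reduced_approxZero (i : Fin 9) :
    |(ball approxZero 0 (reduced i)).1 - 0| + (ball approxZero 0 (reduced i)).2 ≤ 1 / 10 ^ 28 := by
  revert i
  decide +kernel

theorem abs_approxZero_sub_boxCenter_le (i : Fin 9) :
    |approxZero i - boxCenter i| ≤ 1 / 10 ^ 13 := by
  revert i
  decide +kernel

theorem isApproxInverse_approxInv : IsApproxInverse approxInv approxJac jacError (1 / 10) := by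
  unfold IsApproxInverse
  decide +kernel

theorem isApproxInverse_approxInvSymm :
    IsApproxInverse approxInvSymm (approxJac.submatrix symm symm) jacError (1 / 10) := by
  unfold IsApproxInverse
  decide +kernel

theorem sum_abs_approxInv_le (i : Fin 9) : ∑ k, |approxInv i k| ≤ 70 := by
  revert i
  decide +kernel

theorem abs_approxInv_last_le (i : Fin 9) : |approxInv i 8| ≤ 63 := by
  revert i
  decide +kernel

theorem ball_oddAA :
    let e := oddAA (X 6 ^ 2) (X 6 * X 8) (X 8 ^ 2)
    |(ball configCenter (fun _ => configRadius) e).1 - 13|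
      + (ball configCenter (fun _ => configRadius) e).2 ≤ 1 := by
  decide +kernel

theorem ball_oddAB :
    let e := const (boxCenter 6) * oddAA (X 6 ^ 2) (X 6 * X 8) (X 8 ^ 2)
      + oddAB (X 6 ^ 2) (X 8 ^ 2)
    |(ball configCenter (fun _ => configRadius) e).1 - 0|
      + (ball configCenter (fun _ => configRadius) e).2 ≤ boxRadius := by
  decide +kernel

theorem approxInv_seven_eight : approxInv 7 8 = 24.56531 := rfl

/-- The box in which the reduced system is studied. -/
noncomputable def parBox : Set (Fin 9 → ℝ) :=
  Metric.closedBall (fun i => (boxCenter i : ℝ)) (boxRadius : ℝ)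

theorem boxRadius_pos : (0 : ℝ) < boxRadius := by norm_num [boxRadius]

theorem mem_parBox {ρ : Fin 9 → ℝ} : ρ ∈ parBox ↔ ∀ i, |ρ i - boxCenter i| ≤ boxRadius :=
  dist_pi_le_iff boxRadius_pos.le

theorem convex_parBox : Convex ℝ parBox := convex_closedBall _ _

/-- The reduced system. -/
noncomputable def redMap : (Fin 9 → ℝ) → Fin 9 → ℝ := polyMap reduced

/-- Jacobian matrix of the reduced system. -/
noncomputable def redJac : (Fin 9 → ℝ) → Matrix (Fin 9) (Fin 9) ℝ := polyJac reduced

theorem redMap_eight (ρ : Fin 9 → ℝ) : redMap ρ 8 = ρ 8 := rfl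

theorem hasDerivAt_redMap_update (ρ : Fin 9 → ℝ) (j i : Fin 9) :
    HasDerivAt (fun s => redMap (Function.update ρ j s) i) (redJac ρ i j) (ρ j) := by
  have := hasDerivAt_eval_update (reduced i) ρ j (ρ j)
  rwa [Function.update_eq_self] at this

theorem redJac_mulVec_eight (ρ u : Fin 9 → ℝ) : (redJac ρ *ᵥ u) 8 = u 8 := by
  simp [redJac, polyJac, reduced, Matrix.mulVec, dotProduct]

theorem contDiff_redMap : ContDiff ℝ ω redMap := contDiff_polyMap reduced

theorem hasFDerivAt_redMap (ρ : Fin 9 → ℝ) :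
    HasFDerivAt redMap (redJac ρ).mulVecLin.toContinuousLinearMap ρ :=
  hasFDerivAt_polyMap reduced ρ

theorem abs_redJac_sub_le {ρ : Fin 9 → ℝ} (h : ρ ∈ parBox) (i j : Fin 9) :
    |redJac ρ i j - approxJac i j| ≤ jacError :=
  abs_eval_sub_le_of_ball (ball_pderiv_reduced i j) (mem_parBox.1 h)

theorem exists_redMap_sub_eq {ρ σ : Fin 9 → ℝ} (hρ : ρ ∈ parBox) (hσ : σ ∈ parBox) :
    ∃ J : Matrix (Fin 9) (Fin 9) ℝ, (∀ i j, |J i j - approxJac i j| ≤ jacError) ∧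
      redMap ρ - redMap σ = J *ᵥ (ρ - σ) :=
  exists_polyMap_sub_eq convex_parBox (fun _ => abs_redJac_sub_le) hρ hσ

theorem injOn_redMap : Set.InjOn redMap parBox := by
  intro ρ hρ σ hσ h
  obtain ⟨J, hJ, hsub⟩ := exists_redMap_sub_eq hρ hσ
  refine sub_eq_zero.1
    (isApproxInverse_approxInv.eq_zero_of_mulVec_eq_zero (by norm_num) hJ ?_)
  rw [← hsub, h, sub_self]

section NearJac

variable {J : Matrix (Fin 9) (Fin 9) ℝ} (hJ : ∀ i j, |J i j - approxJac i j| ≤ jacError)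
include hJ

theorem eq_zero_of_submatrix_symm_mulVec {u : Fin 6 → ℝ}
    (h : J.submatrix symm symm *ᵥ u = 0) : u = 0 :=
  isApproxInverse_approxInvSymm.eq_zero_of_mulVec_eq_zero (by norm_num) (fun _ _ => hJ _ _) h

/-- For `s = 1`, the derivative of `m` in `T` along the zeros of the reduced system is about `24`.
This makes the pitchfork supercritical. -/
theorem abs_apply_seven_sub_le {u : Fin 9 → ℝ} {s : ℝ} (h : J *ᵥ u = Pi.single 8 s) :
    |u 7 - 24 * s| ≤ 8 * |s| := by
  have hcol : approxInv.map (Rat.cast : ℚ → ℝ) *ᵥ Pi.single 8 s =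
      fun i => (approxInv i 8 : ℝ) * s := by
    ext i
    simp
  have hle := isApproxInverse_approxInv.norm_sub_mulVec_le hJ u
  rw [h, hcol] at hle
  have hcoord : ∀ i, |u i - approxInv i 8 * s| ≤ 1 / 10 * ‖u‖ := fun i => by
    simpa using (norm_le_pi_norm _ i).trans hle
  have hbound : ∀ i, |(approxInv i 8 : ℝ)| ≤ 63 := fun i => by
    exact_mod_cast abs_approxInv_last_le i
  have hnorm : ‖u‖ ≤ 63 * |s| + 1 / 10 * ‖u‖ := by
    refine (pi_norm_le_iff_of_nonempty _).2 fun i => ?_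
    have := mul_le_mul_of_nonneg_right (hbound i) (abs_nonneg s)
    rw [← abs_mul] at this
    rw [Real.norm_eq_abs]
    linarith [hcoord i, abs_sub_abs_le_abs_sub (u i) (approxInv i 8 * s)]
  have hseven : (approxInv 7 8 : ℝ) = 24.56531 := by norm_num [approxInv_seven_eight]
  have habs : |(approxInv 7 8 : ℝ) * s - 24 * s| = 0.56531 * |s| := by
    rw [← sub_mul, abs_mul, hseven]
    norm_num
  linarith [abs_sub_le (u 7) (approxInv 7 8 * s) (24 * s), hcoord 7, abs_nonneg s]

theorem eq_zero_of_mulVec_eq_single {u : Fin 9 → ℝ} {s : ℝ} (h : J *ᵥ u = Pi.single 8 s)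
    (h7 : u 7 = 0) : u = 0 := by
  have hs := abs_apply_seven_sub_le hJ h
  rw [h7, zero_sub, abs_neg, abs_mul, abs_of_pos (by norm_num : (0 : ℝ) < 24)] at hs
  obtain rfl : s = 0 := abs_eq_zero.1 (by linarith [abs_nonneg s])
  rw [Pi.single_zero] at h
  exact isApproxInverse_approxInv.eq_zero_of_mulVec_eq_zero (by norm_num) hJ h

end NearJac

theorem exists_redMap_eq_zero :
    ∃ ρ : Fin 9 → ℝ, (∀ i, |ρ i - approxZero i| ≤ 1 / 10 ^ 26) ∧ redMap ρ = 0 := by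
  set c : Fin 9 → ℝ := fun i => approxZero i
  set P := approxInv.map (Rat.cast : ℚ → ℝ)
  have hbox : Metric.closedBall c (1 / 10 ^ 26) ⊆ parBox := by
    refine Metric.closedBall_subset_closedBall' ?_
    have hcert (i : Fin 9) : |(approxZero i : ℝ) - boxCenter i| ≤ 1 / 10 ^ 13 := by
      simpa using (Rat.cast_le (K := ℝ)).2 (abs_approxZero_sub_boxCenter_le i)
    have hdist : dist c (fun i => (boxCenter i : ℝ)) ≤ 1 / 10 ^ 13 :=
      (dist_pi_le_iff (by norm_num)).2 hcert
    norm_num [boxRadius] at hdist ⊢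
    linarith
  have hcontr : ∀ x ∈ Metric.closedBall c (1 / 10 ^ 26), ∀ y ∈ Metric.closedBall c (1 / 10 ^ 26),
      ‖(x - y) - (P *ᵥ redMap x - P *ᵥ redMap y)‖ ≤ (1 / 10 : NNReal) * ‖x - y‖ := by
    intro x hx y hy
    obtain ⟨J, hJ, hsub⟩ := exists_redMap_sub_eq (hbox hx) (hbox hy)
    simpa [← Matrix.mulVec_sub, hsub] using isApproxInverse_approxInv.norm_sub_mulVec_le hJ (x - y)
  have hzero : ∀ i, |redMap c i| ≤ 1 / 10 ^ 28 := fun i => by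
    change |eval c (reduced i)| ≤ _
    simpa using abs_eval_sub_le_of_ball (ball_reduced_approxZero i) (x := c) (by simp [c])
  have hres : ‖P *ᵥ redMap c‖ ≤ (1 - (1 / 10 : NNReal)) * (1 / 10 ^ 26) := by
    refine (pi_norm_le_iff_of_nonempty _).2 fun i => ?_
    have hsum : ∑ k, |P i k| ≤ 70 := by
      simp only [P, Matrix.map_apply]
      exact_mod_cast sum_abs_approxInv_le i
    calc |∑ k, P i k * redMap c k| ≤ ∑ k, |P i k| * (1 / 10 ^ 28) := by
          refine (Finset.abs_sum_le_sum_abs _ _).trans (Finset.sum_le_sum fun k _ => ?_)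
          rw [abs_mul]
          exact mul_le_mul_of_nonneg_left (hzero k) (abs_nonneg _)
      _ = (∑ k, |P i k|) * (1 / 10 ^ 28) := (Finset.sum_mul ..).symm
      _ ≤ 70 * (1 / 10 ^ 28) := by gcongr
      _ ≤ _ := by norm_num
  obtain ⟨ρ, hρ, hP⟩ := exists_mem_closedBall_eq_zero (g := fun x => P *ᵥ redMap x)
    (by rw [← NNReal.coe_lt_coe]; norm_num) hcontr hres
  exact ⟨ρ, (dist_pi_le_iff (by norm_num)).1 hρ,
    (isApproxInverse_approxInv.mulVec_eq_zero_iff (by norm_num [jacError]) (by norm_num)).1 hP⟩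

/-! ## Splitting the Dziobek equations -/

/-- The Cayley-Menger determinant as a polynomial in the unknowns. -/
def cmPoly : PolyExpr (Fin 8) :=
  let A := var 2 ^ 2
  let B := var 3 ^ 2
  let C := var 4 ^ 2
  let D := var 5 ^ 2
  let E := var 6 ^ 2
  let F := var 7 ^ 2
  2 * (A * F * (B + C + D + E - A - F) + B * E * (A + C + D + F - B - E)
    + C * D * (A + B + E + F - C - D) - A * B * D - A * C * E - B * C * F - D * E * F)

set_option maxHeartbeats 1000000 in
-- The determinant has 120 terms.
theorem cmDet_eq_eval (x : Vec) : cmDet x = eval x cmPoly := by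
  rw [cmDet, Matrix.det_succ_row_zero]
  simp only [Fin.sum_univ_five]
  iterate 5 rw [Matrix.det_succ_row_zero]
  simp only [Fin.sum_univ_four, Matrix.det_fin_three]
  simp [cayleyMenger, Fin.succAbove, cmPoly]
  ring

theorem partialDeriv_cmDet (x : Vec) (k : Fin 8) :
    partialDeriv cmDet k x = eval x (pderiv k cmPoly) := by
  simp only [partialDeriv, cmDet_eq_eval, (hasDerivAt_eval_update _ _ _ _).deriv,
    Function.update_eq_self]

theorem dziobek_apply (x : Vec) (m : ℝ) : dziobek x m = ![
    x 2 ^ 2 + x 3 ^ 2 + m * x 4 ^ 2 + x 5 ^ 2 + m * x 6 ^ 2 + m * x 7 ^ 2 - (3 + m),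
    eval x cmPoly,
    -(3 + m) + 2 * x 0 * x 2 ^ 3 + x 1 * (3 + m) * x 2 ^ 2 * eval x (pderiv 2 cmPoly),
    -(3 + m) + 2 * x 0 * x 3 ^ 3 + x 1 * (3 + m) * x 3 ^ 2 * eval x (pderiv 3 cmPoly),
    -(3 + m) * m + 2 * x 0 * m * x 4 ^ 3 + x 1 * (3 + m) * x 4 ^ 2 * eval x (pderiv 4 cmPoly),
    -(3 + m) + 2 * x 0 * x 5 ^ 3 + x 1 * (3 + m) * x 5 ^ 2 * eval x (pderiv 5 cmPoly),
    -(3 + m) * m + 2 * x 0 * m * x 6 ^ 3 + x 1 * (3 + m) * x 6 ^ 2 * eval x (pderiv 6 cmPoly),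
    -(3 + m) * m + 2 * x 0 * m * x 7 ^ 3
      + x 1 * (3 + m) * x 7 ^ 2 * eval x (pderiv 7 cmPoly)] := by
  ext k
  fin_cases k <;>
    simp [dziobek, pairMass, partialDeriv_cmDet, cmDet_eq_eval,
      show Finset.Ici (2 : Fin 8) = {2, 3, 4, 5, 6, 7} by decide]
  ring

theorem contDiff_dziobek : ContDiff ℝ ω (fun p : Vec × ℝ => dziobek p.1 p.2) := by
  have hpoly (e : PolyExpr (Fin 8)) : ContDiff ℝ ω (fun p : Vec × ℝ => eval p.1 e) :=
    (contDiff_eval e).comp contDiff_fst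
  simp only [dziobek_apply]
  rw [contDiff_pi]
  intro k
  fin_cases k <;>
    simp only [Fin.zero_eta, Fin.mk_one, Fin.reduceFinMk, Matrix.cons_val, Matrix.cons_val_zero,
      Matrix.cons_val_one] <;>
    fun_prop

/-- The configuration with parts `(λ₀, μ, c, a, b, d)` and `(α, t)` that are symmetric and
antisymmetric under the exchange of the bodies 1 and 2. -/
noncomputable def assemble : ((Fin 6 → ℝ) × ℝ × ℝ) ≃L[ℝ] Vec :=
  LinearEquiv.toContinuousLinearEquiv
    { toFun := fun p => ![p.1 0, p.1 1, p.1 2, p.1 3 - p.2.1, p.1 4 - p.2.2, p.1 3 + p.2.1,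
        p.1 4 + p.2.2, p.1 5]
      invFun := fun x => (![x 0, x 1, x 2, (x 3 + x 5) / 2, (x 4 + x 6) / 2, x 7],
        (x 5 - x 3) / 2, (x 6 - x 4) / 2)
      map_add' := fun p q => by ext k; fin_cases k <;> simp <;> ring
      map_smul' := fun c p => by ext k; fin_cases k <;> simp <;> ring
      left_inv := fun p => by ext k <;> [fin_cases k; skip; skip] <;> simp
      right_inv := fun x => by ext k; fin_cases k <;> simp <;> ring }

theorem assemble_apply (e : Fin 6 → ℝ) (α t : ℝ) :
    assemble (e, α, t) = ![e 0, e 1, e 2, e 3 - α, e 4 - t, e 3 + α, e 4 + t, e 5] := rfl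

theorem dziobek_assemble {ξ : Fin 9 → ℝ} {α t : ℝ} {p q r : PolyExpr (Fin 9)}
    (hp : eval ξ p = α ^ 2) (hq : eval ξ q = α * t) (hr : eval ξ r = t ^ 2) :
    dziobek (assemble (ξ ∘ symm, α, t)) (ξ 7) =
      assemble (fun i => eval ξ (even p q r i),
        α * eval ξ (oddAA p q r) + t * eval ξ (oddAB p r),
        α * eval ξ (oddBA p r) + t * eval ξ (oddBB p q r)) := by
  rw [dziobek_apply]
  ext k
  fin_cases k <;>
  · simp [assemble_apply, cmPoly, symm, even, oddAA, oddAB, oddBA, oddBB, cubeA, cubeA', cubeB,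
      cubeB', cmAA, cmAB, cmBB, cmA, cmB, cmC, cmD, cmEven, sqA, sqB, totalMass, hp, hq, hr]
    ring

/-- The configuration with parameters `(λ₀, μ, c, a, b, d, β)` and antisymmetric part
`(β t, t)`. -/
noncomputable def toVec (ρ : Fin 9 → ℝ) (t : ℝ) : Vec := assemble (ρ ∘ symm, ρ 6 * t, t)

theorem dziobek_toVec {ρ : Fin 9 → ℝ} {t : ℝ} (h : ρ 8 = t ^ 2) :
    dziobek (toVec ρ t) (ρ 7) =
      assemble (redMap ρ ∘ symm, t * redMap ρ 6, t * redMap ρ 7) := by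
  have hp : eval ρ (var 8 * (var 6 : PolyExpr (Fin 9)) ^ 2) = (ρ 6 * t) ^ 2 := by simp [h]; ring
  have hq : eval ρ (var 8 * var 6) = ρ 6 * t * t := by simp [h]; ring
  unfold toVec
  rw [dziobek_assemble hp hq (show eval ρ (var 8) = t ^ 2 from h)]
  congr 2
  · ext i
    fin_cases i <;> rfl
  · simp only [redMap, polyMap, reduced, Matrix.cons_val, eval_add, eval_mul, eval_var]
    congr 1 <;> ring

theorem dziobek_toVec_eq_zero_iff {ρ : Fin 9 → ℝ} {t : ℝ} (h : ρ 8 = t ^ 2) :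
    dziobek (toVec ρ t) (ρ 7) = 0 ↔
      redMap ρ ∘ symm = 0 ∧ t * redMap ρ 6 = 0 ∧ t * redMap ρ 7 = 0 := by
  rw [dziobek_toVec h, map_eq_zero_iff _ assemble.injective, Prod.mk_eq_zero, Prod.mk_eq_zero]

theorem contDiff_dziobek_left (m : ℝ) : ContDiff ℝ ω (fun z => dziobek z m) :=
  contDiff_dziobek.comp₂ contDiff_id contDiff_const

theorem differentiable_dziobek_left (m : ℝ) : Differentiable ℝ (fun z => dziobek z m) :=
  (contDiff_dziobek_left m).differentiable (by simp)

theorem jacobian_mulVec (x : Vec) (m : ℝ) (n : Vec) :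
    jacobian x m *ᵥ n = fderiv ℝ (fun z => dziobek z m) x n := by
  rw [jacobian, ← Matrix.toLin'_apply, Matrix.toLin'_toMatrix']
  rfl

theorem hasDerivAt_toVec {γ : ℝ → Fin 9 → ℝ} {γ' : Fin 9 → ℝ} {τ : ℝ → ℝ} {τ' s : ℝ}
    (hγ : HasDerivAt γ γ' s) (hτ : HasDerivAt τ τ' s) :
    HasDerivAt (fun s => toVec (γ s) (τ s))
      (assemble (γ' ∘ symm, γ' 6 * τ s + γ s 6 * τ', τ')) s :=
  have hcoord := hasDerivAt_pi.1 hγ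
  assemble.toContinuousLinearMap.hasFDerivAt.comp_hasDerivAt s
    ((hasDerivAt_pi.2 fun i => hcoord (symm i)).prodMk (((hcoord 6).fun_mul hτ).prodMk hτ))

theorem fderiv_dziobek_toVec {ρ σ : Fin 9 → ℝ} {t t' : ℝ} (h : ρ 8 = t ^ 2) (h7 : σ 7 = 0)
    (h8 : σ 8 = 2 * t * t') :
    fderiv ℝ (fun z => dziobek z (ρ 7)) (toVec ρ t) (assemble (σ ∘ symm, σ 6 * t + ρ 6 * t', t')) =
      assemble ((redJac ρ *ᵥ σ) ∘ symm, t' * redMap ρ 6 + t * (redJac ρ *ᵥ σ) 6,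
        t' * redMap ρ 7 + t * (redJac ρ *ᵥ σ) 7) := by
  -- Differentiate `dziobek_toVec` along a curve that respects the constraint `ρ 8 = t ^ 2`.
  set γ : ℝ → Fin 9 → ℝ := fun s => Function.update (ρ + s • σ) 8 ((t + s * t') ^ 2) with hγ
  have hγ_zero : γ 0 = ρ := by simp [hγ, ← h]
  have hγ_seven (s : ℝ) : γ s 7 = ρ 7 := by simp [hγ, h7]
  have hlin (a b : ℝ) : HasDerivAt (fun s : ℝ => a + s * b) b 0 := by
    simpa using ((hasDerivAt_id (0 : ℝ)).mul_const b).const_add a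
  have hγ_deriv : HasDerivAt γ σ 0 := by
    refine hasDerivAt_pi.2 fun i => ?_
    rcases eq_or_ne i 8 with rfl | hi
    · simpa [hγ, h8] using (hlin t t').fun_pow 2
    · simpa [hγ, hi] using hlin (ρ i) (σ i)
  have hred (i : Fin 9) : HasDerivAt (fun s => redMap (γ s) i) ((redJac ρ *ᵥ σ) i) 0 := by
    have := (hasFDerivAt_redMap (γ 0)).comp_hasDerivAt 0 hγ_deriv
    rw [hγ_zero] at this
    exact hasDerivAt_pi.1 this i
  have himage : HasDerivAt (fun s => dziobek (toVec (γ s) (t + s * t')) (ρ 7))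
      (assemble ((redJac ρ *ᵥ σ) ∘ symm, t' * redMap ρ 6 + t * (redJac ρ *ᵥ σ) 6,
        t' * redMap ρ 7 + t * (redJac ρ *ᵥ σ) 7)) 0 := by
    have heq (s : ℝ) := hγ_seven s ▸ dziobek_toVec (ρ := γ s) (t := t + s * t') (by simp [hγ])
    simp only [heq]
    refine assemble.toContinuousLinearMap.hasFDerivAt.comp_hasDerivAt (0 : ℝ)
      ((hasDerivAt_pi.2 fun i => hred (symm i)).prodMk (HasDerivAt.prodMk ?_ ?_))
    · simpa [hγ_zero] using (hlin t t').fun_mul (hred 6)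
    · simpa [hγ_zero] using (hlin t t').fun_mul (hred 7)
  have hcurve := hasDerivAt_toVec hγ_deriv (hlin t t')
  have hchain := (differentiable_dziobek_left (ρ 7)
    (toVec (γ 0) (t + 0 * t'))).hasFDerivAt.comp_hasDerivAt 0 hcurve
  simpa [hγ_zero] using hchain.unique himage

/-- The point of `Fin 9 → ℝ` with coordinates `e` at the indices in the range of `symm` and
`u`, `v`, `w` at the others. -/
def ofParts (e : Fin 6 → ℝ) (u v w : ℝ) : Fin 9 → ℝ :=
  ![e 0, e 1, e 2, e 3, e 4, e 5, u, v, w]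

@[simp] theorem ofParts_six (e : Fin 6 → ℝ) (u v w : ℝ) : ofParts e u v w 6 = u := rfl
@[simp] theorem ofParts_seven (e : Fin 6 → ℝ) (u v w : ℝ) : ofParts e u v w 7 = v := rfl
@[simp] theorem ofParts_eight (e : Fin 6 → ℝ) (u v w : ℝ) : ofParts e u v w 8 = w := rfl

@[simp] theorem ofParts_symm (e : Fin 6 → ℝ) (u v w : ℝ) (i : Fin 6) :
    ofParts e u v w (symm i) = e i := by
  fin_cases i <;> rfl

@[simp] theorem ofParts_comp_symm (e : Fin 6 → ℝ) (u v w : ℝ) : ofParts e u v w ∘ symm = e :=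
  funext (ofParts_symm e u v w)

theorem forall_fin_nine {p : Fin 9 → Prop} :
    (∀ i, p i) ↔ (∀ i, p (symm i)) ∧ p 6 ∧ p 7 ∧ p 8 := by
  refine ⟨fun h => ⟨fun i => h _, h 6, h 7, h 8⟩, fun ⟨h, h6, h7, h8⟩ i => ?_⟩
  fin_cases i
  exacts [h 0, h 1, h 2, h 3, h 4, h 5, h6, h7, h8]

theorem eq_iff_comp_symm {ρ σ : Fin 9 → ℝ} :
    ρ = σ ↔ ρ ∘ symm = σ ∘ symm ∧ ρ 6 = σ 6 ∧ ρ 7 = σ 7 ∧ ρ 8 = σ 8 := by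
  simp only [funext_iff, forall_fin_nine (p := fun i => ρ i = σ i), Function.comp_apply]

theorem mulVec_ofParts_comp_symm (M : Matrix (Fin 9) (Fin 9) ℝ) (e : Fin 6 → ℝ) :
    (M *ᵥ ofParts e 0 0 0) ∘ symm = M.submatrix symm symm *ᵥ e := by
  ext i
  simp [Matrix.mulVec, dotProduct, Fin.sum_univ_succ, ofParts, symm]

@[simp] theorem toVec_ofParts (e : Fin 6 → ℝ) (β m T t : ℝ) :
    toVec (ofParts e β m T) t = assemble (e, β * t, t) := by
  simp [toVec]

/-- The antisymmetric parameter `t` of a configuration. -/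
noncomputable def skew (x : Vec) : ℝ := (x 6 - x 4) / 2

@[simp] theorem skew_assemble (e : Fin 6 → ℝ) (α t : ℝ) : skew (assemble (e, α, t)) = t := by
  simp [skew, assemble_apply]

@[simp] theorem skew_toVec (ρ : Fin 9 → ℝ) (t : ℝ) : skew (toVec ρ t) = t := skew_assemble _ _ _

theorem continuous_skew : Continuous skew := by
  unfold skew
  fun_prop

theorem redMap_six_eq {ρ : Fin 9 → ℝ} {t : ℝ} (h : ρ 8 = t ^ 2) :
    let ξ := ofParts (ρ ∘ symm) (ρ 6 * t) (ρ 7) t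
    redMap ρ 6 = ρ 6 * eval ξ (oddAA (X 6 ^ 2) (X 6 * X 8) (X 8 ^ 2))
      + eval ξ (oddAB (X 6 ^ 2) (X 8 ^ 2)) := by
  simp [-mul_eq_mul_left_iff, -mul_eq_mul_right_iff, -add_right_inj, -add_left_inj, ofParts, symm,
    redMap, polyMap, reduced, oddAA, oddAB, cubeA, cubeA', cmAA, cmAB, cmA, sqA, sqB, totalMass, h]
  ring

/-- Neighbourhood of the bifurcating configuration. -/
noncomputable def vecBox : Set Vec :=
  Metric.ball (toVec (fun i => (boxCenter i : ℝ)) 0) configRadius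

theorem isOpen_vecBox : IsOpen vecBox := Metric.isOpen_ball

/-- Neighbourhood of the bifurcation value of the mass. -/
noncomputable def massBox : Set ℝ := Metric.ball (boxCenter 7 : ℝ) configRadius

theorem configRadius_pos : (0 : ℝ) < configRadius := by norm_num [configRadius]

theorem mem_vecBox {x : Vec} : x ∈ vecBox ↔
    ∀ k, |x k - toVec (fun i => (boxCenter i : ℝ)) 0 k| < configRadius :=
  dist_pi_lt_iff configRadius_pos

section ConfigBox

variable {e : Fin 6 → ℝ} {α t m : ℝ}

theorem abs_ofParts_sub_configCenter_le (hx : assemble (e, α, t) ∈ vecBox) (hm : m ∈ massBox)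
    (i : Fin 9) : |ofParts e α m t i - configCenter i| ≤ configRadius := by
  have hcoord (k : Fin 8) := abs_lt.1 (mem_vecBox.1 hx k)
  simp only [toVec, mul_zero, assemble_apply] at hcoord
  have h3 := hcoord 3
  have h4 := hcoord 4
  have h5 := hcoord 5
  have h6 := hcoord 6
  simp only [Matrix.cons_val, sub_zero, add_zero, Function.comp_apply] at h3 h4 h5 h6
  fin_cases i
  · exact (abs_lt.2 (hcoord 0)).le
  · exact (abs_lt.2 (hcoord 1)).le
  · exact (abs_lt.2 (hcoord 2)).le
  · exact abs_le.2 (show _ ≤ e 3 - boxCenter (symm 3) ∧ e 3 - boxCenter (symm 3) ≤ _ by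
      constructor <;> linarith)
  · exact abs_le.2 (show _ ≤ e 4 - boxCenter (symm 4) ∧ e 4 - boxCenter (symm 4) ≤ _ by
      constructor <;> linarith)
  · exact (abs_lt.2 (hcoord 7)).le
  · change |α - ((0 : ℚ) : ℝ)| ≤ _
    rw [abs_le, Rat.cast_zero]
    constructor <;> linarith
  · exact (Metric.mem_ball.1 hm).le
  · change |t - ((0 : ℚ) : ℝ)| ≤ _
    rw [abs_le, Rat.cast_zero]
    constructor <;> linarith

theorem le_eval_oddAA {ξ : Fin 9 → ℝ} (h : ∀ i, |ξ i - configCenter i| ≤ configRadius) :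
    12 ≤ eval ξ (oddAA (X 6 ^ 2) (X 6 * X 8) (X 8 ^ 2)) := by
  have := abs_eval_sub_le_of_ball ball_oddAA h
  push_cast at this
  linarith [(abs_le.1 this).1]

theorem abs_sub_boxCenter_six_le {ξ : Fin 9 → ℝ}
    (h : ∀ i, |ξ i - configCenter i| ≤ configRadius) {β : ℝ}
    (hβ : β * eval ξ (oddAA (X 6 ^ 2) (X 6 * X 8) (X 8 ^ 2))
      + eval ξ (oddAB (X 6 ^ 2) (X 8 ^ 2)) = 0) : |β - boxCenter 6| ≤ boxRadius := by
  have hAA := le_eval_oddAA h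
  have hAB := abs_eval_sub_le_of_ball ball_oddAB h
  simp only [eval_add, eval_mul, eval_const, Rat.cast_zero, sub_zero] at hAB
  set A := eval ξ (oddAA (X 6 ^ 2) (X 6 * X 8) (X 8 ^ 2))
  rw [show (boxCenter 6 : ℝ) * A + eval ξ (oddAB (X 6 ^ 2) (X 8 ^ 2))
    = -((β - boxCenter 6) * A) by linear_combination hβ, abs_neg, abs_mul,
    abs_of_pos (by linarith : 0 < A)] at hAB
  nlinarith [abs_nonneg (β - boxCenter 6)]

theorem ofParts_mem_parBox (hx : assemble (e, α, t) ∈ vecBox) (hm : m ∈ massBox) {β : ℝ}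
    (hβ : |β - boxCenter 6| ≤ boxRadius) : ofParts e β m (t ^ 2) ∈ parBox := by
  have hξ := abs_ofParts_sub_configCenter_le hx hm
  have hradius : (configRadius : ℝ) ≤ boxRadius := by norm_num [configRadius, boxRadius]
  refine mem_parBox.2 (forall_fin_nine.2 ⟨fun i => ?_, ?_, ?_, ?_⟩)
  · have hi := hξ (symm i)
    rw [configCenter, Function.update_of_ne (by clear hi; decide +revert), ofParts_symm] at hi
    rw [ofParts_symm]
    exact hi.trans hradius
  · rwa [ofParts_six]
  · have hi := hξ 7
    rw [configCenter, Function.update_of_ne (by decide), ofParts_seven] at hi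
    rw [ofParts_seven]
    exact hi.trans hradius
  · have ht : |t| ≤ configRadius := by simpa [configCenter, boxCenter] using hξ 8
    have hone : (configRadius : ℝ) ≤ 1 := by norm_num [configRadius]
    have hc : (boxCenter 8 : ℝ) = 0 := by simp [boxCenter]
    rw [ofParts_eight, hc, sub_zero, abs_pow]
    nlinarith [abs_nonneg t]

theorem mem_parBox_of_redMap_six {ρ : Fin 9 → ℝ} (hx : toVec ρ t ∈ vecBox) (hm : ρ 7 ∈ massBox)
    (h8 : ρ 8 = t ^ 2) (h6 : redMap ρ 6 = 0) : ρ ∈ parBox := by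
  have hβ := abs_sub_boxCenter_six_le (abs_ofParts_sub_configCenter_le hx hm)
    ((redMap_six_eq h8).symm.trans h6)
  convert ofParts_mem_parBox hx hm hβ
  simp [eq_iff_comp_symm, h8]

end ConfigBox

theorem eq_single_eight_iff {u : Fin 9 → ℝ} {s : ℝ} :
    u = Pi.single 8 s ↔ u ∘ symm = 0 ∧ u 6 = 0 ∧ u 7 = 0 ∧ u 8 = s := by
  have hsymm : (Pi.single 8 s : Fin 9 → ℝ) ∘ symm = 0 := by
    ext i
    fin_cases i <;> simp [symm]
  simp [eq_iff_comp_symm, hsymm]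

theorem redMap_eq_single_iff {ρ : Fin 9 → ℝ} {t : ℝ} :
    redMap ρ = Pi.single 8 (t ^ 2) ↔
      redMap ρ ∘ symm = 0 ∧ redMap ρ 6 = 0 ∧ redMap ρ 7 = 0 ∧ ρ 8 = t ^ 2 := by
  rw [eq_single_eight_iff, redMap_eight]

section Parametrization

variable {x : Vec} {m : ℝ}

theorem exists_redMap_eq_single (hx : x ∈ vecBox) (hm : m ∈ massBox) (h : dziobek x m = 0)
    (hs : skew x ≠ 0) :
    ∃ ρ ∈ parBox, ρ 7 = m ∧ toVec ρ (skew x) = x ∧ redMap ρ = Pi.single 8 (skew x ^ 2) := by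
  obtain ⟨⟨e, α, t⟩, rfl⟩ := assemble.surjective x
  rw [skew_assemble] at hs ⊢
  have hvec : toVec (ofParts e (α / t) m (t ^ 2)) t = assemble (e, α, t) := by
    rw [toVec_ofParts, div_mul_cancel₀ _ hs]
  have hzero := (dziobek_toVec_eq_zero_iff (ofParts_eight ..)).1 (hvec.symm ▸ h)
  simp only [mul_eq_zero, hs, false_or] at hzero
  exact ⟨_, mem_parBox_of_redMap_six (hvec.symm ▸ hx) hm (ofParts_eight ..) hzero.2.1, rfl, hvec,
    redMap_eq_single_iff.2 ⟨hzero.1, hzero.2.1, hzero.2.2, rfl⟩⟩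

theorem exists_redMap_comp_symm_eq_zero (hx : x ∈ vecBox) (hm : m ∈ massBox)
    (h : dziobek x m = 0) (hs : skew x = 0) :
    ∃ ρ ∈ parBox, ρ 6 = boxCenter 6 ∧ ρ 7 = m ∧ ρ 8 = 0 ∧ toVec ρ 0 = x ∧
      redMap ρ ∘ symm = 0 := by
  obtain ⟨⟨e, α, t⟩, rfl⟩ := assemble.surjective x
  obtain rfl : t = 0 := by simpa using hs
  have hodd := dziobek_assemble (ξ := ofParts e α m 0) (α := α) (t := 0) (p := X 6 ^ 2)
    (q := X 6 * X 8) (r := X 8 ^ 2) (by simp) (by simp) (by simp)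
  rw [ofParts_comp_symm, ofParts_seven, h, eq_comm, map_eq_zero_iff _ assemble.injective,
    Prod.mk_eq_zero, Prod.mk_eq_zero] at hodd
  have hα : α = 0 := by
    have hAA := le_eval_oddAA (abs_ofParts_sub_configCenter_le hx hm)
    refine (mul_eq_zero.1 ?_).resolve_right (lt_of_lt_of_le (by norm_num) hAA).ne'
    simpa using hodd.2.1
  subst hα
  set ρ := ofParts e (boxCenter 6) m 0
  have hvec : toVec ρ 0 = assemble (e, 0, 0) := by simp [ρ]
  refine ⟨ρ, ?_, rfl, rfl, rfl, hvec, ?_⟩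
  · simpa using ofParts_mem_parBox hx hm (β := boxCenter 6) (by simpa using boxRadius_pos.le)
  · exact ((dziobek_toVec_eq_zero_iff (by simp [ρ])).1 (hvec.symm ▸ h)).1

end Parametrization

theorem update_comp_symm {j : Fin 9} (hj : 6 ≤ j) (ρ : Fin 9 → ℝ) (u : ℝ) :
    Function.update ρ j u ∘ symm = ρ ∘ symm :=
  Function.update_comp_eq_of_notMem_range _ _ (by decide +revert)

theorem toVec_update_six_zero (ρ : Fin 9 → ℝ) (β : ℝ) :
    toVec (Function.update ρ 6 β) 0 = toVec ρ 0 := by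
  simp [toVec, update_comp_symm]

theorem toVec_update_seven (ρ : Fin 9 → ℝ) (μ t : ℝ) :
    toVec (Function.update ρ 7 μ) t = toVec ρ t := by
  simp [toVec, update_comp_symm]

theorem toVec_update_eight (ρ : Fin 9 → ℝ) (T t : ℝ) :
    toVec (Function.update ρ 8 T) t = toVec ρ t := by
  simp [toVec, update_comp_symm]

theorem redMap_update_six {ρ : Fin 9 → ℝ} (h : ρ 8 = 0) (β : ℝ) (i : Fin 9) :
    redMap (Function.update ρ 6 β) i = redMap ρ i + (β - ρ 6) * redJac ρ i 6 := by
  set f : ℝ → ℝ := fun β => redMap (Function.update ρ 6 β) i with hf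
  have haffine (β : ℝ) : f β = f 0 + β * (f 1 - f 0) := by
    simp only [hf]
    fin_cases i <;>
    · simp [-mul_eq_mul_left_iff, -mul_eq_mul_right_iff, -add_right_inj, -add_left_inj, redMap,
        polyMap, reduced, even, oddAA, oddAB, oddBA, oddBB, cubeA, cubeA', cubeB, cubeB', cmAA,
        cmAB, cmBB, cmA, cmB, cmC, cmD, cmEven, sqA, sqB, totalMass, h]
      try ring
  have hderiv : HasDerivAt f (f 1 - f 0) (ρ 6) := by
    have := ((hasDerivAt_id (ρ 6)).mul_const (f 1 - f 0)).const_add (f 0)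
    simpa [← haffine] using this
  have hslope : redJac ρ i 6 = f 1 - f 0 := (hasDerivAt_redMap_update ρ 6 i).unique hderiv
  have hbase : redMap ρ i = f (ρ 6) := by simp [hf]
  rw [hslope, hbase, haffine (ρ 6)]
  linear_combination haffine β

section Kernel

variable {ρ : Fin 9 → ℝ}

theorem fderiv_dziobek_toVec_zero (h8 : ρ 8 = 0) (e : Fin 6 → ℝ) (α t : ℝ) :
    fderiv ℝ (fun z => dziobek z (ρ 7)) (toVec ρ 0) (assemble (e, α, t)) =
      assemble ((redJac ρ).submatrix symm symm *ᵥ e,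
        t * redMap ρ 6 + (α - t * ρ 6) * redJac ρ 6 6,
        t * redMap ρ 7 + (α - t * ρ 6) * redJac ρ 7 6) := by
  set L := fderiv ℝ (fun z => dziobek z (ρ 7)) (toVec ρ 0)
  have heven : L (assemble (e, 0, 0)) = assemble ((redJac ρ).submatrix symm symm *ᵥ e, 0, 0) := by
    have := fderiv_dziobek_toVec (ρ := ρ) (σ := ofParts e 0 0 0) (t := 0) (t' := 0)
      (by simpa using h8) rfl (by simp)
    simpa [mulVec_ofParts_comp_symm] using this
  have hodd (β : ℝ) : L (assemble (0, β, 1)) = assemble (0, redMap ρ 6 + (β - ρ 6) * redJac ρ 6 6,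
      redMap ρ 7 + (β - ρ 6) * redJac ρ 7 6) := by
    have := fderiv_dziobek_toVec (ρ := Function.update ρ 6 β) (σ := 0) (t := 0) (t' := 1)
      (by simpa using h8) rfl (by simp)
    simpa [toVec_update_six_zero, redMap_update_six h8, L] using this
  have hsplit : assemble (e, α, t) = assemble (e, 0, 0) + (t • assemble (0, ρ 6, 1) +
      (α - t * ρ 6) • (assemble (0, ρ 6 + 1, 1) - assemble (0, ρ 6, 1))) := by
    simp [← map_sub, ← map_smul, ← map_add]
  rw [hsplit]
  simp only [map_add, map_smul, map_sub, heven, hodd]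
  simp only [← map_sub, ← map_smul, ← map_add]
  simp

theorem redJac_six_six_pos (h : ρ ∈ parBox) : 0 < redJac ρ 6 6 := by
  have h66 : |redJac ρ 6 6 - (12.7555 : ℚ)| ≤ (1 / 10 ^ 4 : ℚ) := abs_redJac_sub_le h 6 6
  norm_num [abs_le] at h66
  linarith

/-- The quotient of the antisymmetric parts of the left kernel vector. -/
noncomputable def leftCoeff (ρ : Fin 9 → ℝ) : ℝ := -redJac ρ 7 6 / redJac ρ 6 6

theorem leftCoeff_mul (h : ρ ∈ parBox) : leftCoeff ρ * redJac ρ 6 6 = -redJac ρ 7 6 :=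
  div_mul_cancel₀ _ (redJac_six_six_pos h).ne'

theorem leftCoeff_mem_Icc (h : ρ ∈ parBox) : leftCoeff ρ ∈ Set.Icc (-1.04) (-1.03) := by
  have h66 : |redJac ρ 6 6 - (12.7555 : ℚ)| ≤ (1 / 10 ^ 4 : ℚ) := abs_redJac_sub_le h 6 6
  have h76 : |redJac ρ 7 6 - (13.244 : ℚ)| ≤ (1 / 10 ^ 4 : ℚ) := abs_redJac_sub_le h 7 6
  have hpos : 0 < redJac ρ 6 6 := redJac_six_six_pos h
  norm_num [abs_le] at h66 h76
  rw [leftCoeff, Set.mem_Icc, le_div_iff₀ hpos, div_le_iff₀ hpos]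
  constructor <;> linarith

theorem leftCoeff_mul_redJac_seven_pos (h : ρ ∈ parBox) :
    0 < leftCoeff ρ * redJac ρ 6 7 + redJac ρ 7 7 := by
  have h67 : |redJac ρ 6 7 - (0.7083 : ℚ)| ≤ (1 / 10 ^ 4 : ℚ) := abs_redJac_sub_le h 6 7
  have h77 : |redJac ρ 7 7 - (18.2077 : ℚ)| ≤ (1 / 10 ^ 4 : ℚ) := abs_redJac_sub_le h 7 7
  obtain ⟨hlow, hupp⟩ := leftCoeff_mem_Icc h
  norm_num [abs_le] at h67 h77 hlow hupp
  nlinarith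

theorem leftCoeff_mul_redJac_eight_neg (h : ρ ∈ parBox) :
    leftCoeff ρ * redJac ρ 6 8 + redJac ρ 7 8 < 0 := by
  have h68 : |redJac ρ 6 8 - (58.5214 : ℚ)| ≤ (1 / 10 ^ 4 : ℚ) := abs_redJac_sub_le h 6 8
  have h78 : |redJac ρ 7 8 - (-158.9564 : ℚ)| ≤ (1 / 10 ^ 4 : ℚ) := abs_redJac_sub_le h 7 8
  obtain ⟨hlow, hupp⟩ := leftCoeff_mem_Icc h
  norm_num [abs_le] at h68 h78 hlow hupp
  nlinarith

end Kernel

section Singular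

variable {x : Vec} {m : ℝ}

theorem IsSingularSolution.exists_fderiv_assemble_eq_zero (h : IsSingularSolution x m) :
    ∃ p ≠ 0, fderiv ℝ (fun z => dziobek z m) x (assemble p) = 0 := by
  obtain ⟨n, hn, hker⟩ := Matrix.exists_mulVec_eq_zero_iff.2 h.2
  obtain ⟨p, rfl⟩ := assemble.surjective n
  exact ⟨p, (map_ne_zero_iff _ assemble.injective).1 hn, jacobian_mulVec x m _ ▸ hker⟩

theorem IsSingularSolution.skew_eq_zero (hx : x ∈ vecBox) (hm : m ∈ massBox)
    (h : IsSingularSolution x m) : skew x = 0 := by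
  by_contra hs
  obtain ⟨⟨e, α, t⟩, hn, hker⟩ := h.exists_fderiv_assemble_eq_zero
  obtain ⟨ρ, hρ, rfl, hvec, hred⟩ := exists_redMap_eq_single hx hm h.1 hs
  rw [← hvec] at hker
  have h8 : ρ 8 = skew x ^ 2 := (redMap_eq_single_iff.1 hred).2.2.2
  set σ := ofParts e ((α - ρ 6 * t) / skew x) 0 (2 * skew x * t) with hσ
  have hσ_vec : assemble (σ ∘ symm, σ 6 * skew x + ρ 6 * t, t) = assemble (e, α, t) := by
    simp [hσ, div_mul_cancel₀ _ hs]
  have hred_odd : redMap ρ 6 = 0 ∧ redMap ρ 7 = 0 := by simp [hred]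
  rw [← hσ_vec, fderiv_dziobek_toVec h8 rfl rfl, map_eq_zero_iff _ assemble.injective,
    Prod.mk_eq_zero, Prod.mk_eq_zero] at hker
  simp only [hred_odd, mul_zero, zero_add, mul_eq_zero, hs, false_or] at hker
  have hσ_zero : σ = 0 := by
    refine eq_zero_of_mulVec_eq_single (abs_redJac_sub_le hρ)
      (eq_single_eight_iff.2 ⟨hker.1, hker.2.1, hker.2.2, redJac_mulVec_eight ρ σ⟩) rfl
  obtain rfl : t = 0 := by simpa [hσ, hs] using congrFun hσ_zero 8
  refine hn ?_
  rw [← map_eq_zero_iff _ assemble.injective, ← hσ_vec, hσ_zero]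
  simp

theorem IsSingularSolution.exists_redMap_eq_zero (hx : x ∈ vecBox) (hm : m ∈ massBox)
    (h : IsSingularSolution x m) : ∃ ρ ∈ parBox, ρ 7 = m ∧ toVec ρ 0 = x ∧ redMap ρ = 0 := by
  have hs := h.skew_eq_zero hx hm
  obtain ⟨ρ, hρ, -, rfl, h8, rfl, -⟩ := exists_redMap_comp_symm_eq_zero hx hm h.1 hs
  obtain ⟨⟨e, α, t⟩, hn, hker⟩ := h.exists_fderiv_assemble_eq_zero
  rw [fderiv_dziobek_toVec_zero h8, map_eq_zero_iff _ assemble.injective, Prod.mk_eq_zero,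
    Prod.mk_eq_zero] at hker
  obtain ⟨he, hodd₆, hodd₇⟩ := hker
  obtain rfl := eq_zero_of_submatrix_symm_mulVec (abs_redJac_sub_le hρ) he
  have ht : t ≠ 0 := by
    rintro rfl
    exact hn (by simpa [(redJac_six_six_pos hρ).ne'] using hodd₆)
  set σ := Function.update ρ 6 (α / t) with hσ
  have hσ_eight : σ 8 = 0 ^ 2 := by simpa [hσ] using h8
  have hvec : toVec σ 0 = toVec ρ 0 := toVec_update_six_zero ρ _
  have hred (i : Fin 9) (hi : t * redMap ρ i + (α - t * ρ 6) * redJac ρ i 6 = 0) :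
      redMap σ i = 0 := by
    rw [redMap_update_six h8]
    field_simp
    linear_combination hi
  have hσ_symm : redMap σ ∘ symm = 0 :=
    ((dziobek_toVec_eq_zero_iff hσ_eight).1 (hvec.symm ▸ h.1)).1
  refine ⟨σ, mem_parBox_of_redMap_six (hvec.symm ▸ hx) hm hσ_eight (hred 6 hodd₆), rfl, hvec, ?_⟩
  simpa using redMap_eq_single_iff.2 ⟨hσ_symm, hred 6 hodd₆, hred 7 hodd₇, hσ_eight⟩

end Singular

/-- A zero of the reduced system whose configuration is the bifurcating one. -/
structure IsBifurcationPoint (ρ : Fin 9 → ℝ) : Prop where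
  nhds : parBox ∈ 𝓝 ρ
  vec : toVec ρ 0 ∈ vecBox
  mass : ρ 7 ∈ massBox
  zero : redMap ρ = 0

/-- The right kernel vector at the configuration with parameters `ρ`. -/
noncomputable def rightKer (ρ : Fin 9 → ℝ) : Vec := assemble (0, ρ 6, 1)

/-- The left kernel vector at the configuration with parameters `ρ`. -/
noncomputable def leftKer (ρ : Fin 9 → ℝ) : Vec := assemble (0, leftCoeff ρ, 1)

section Conditions

variable {ρ : Fin 9 → ℝ}

theorem Phi_g3_assemble (e : Fin 6 → ℝ) (α t : ℝ) :
    Phi .g3 (assemble (e, α, t)) = assemble (e, -α, -t) := by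
  ext k
  fin_cases k <;> simp [Phi, assemble_apply, sub_eq_add_neg]

theorem Phi_g3_toVec (ρ : Fin 9 → ℝ) (t : ℝ) : Phi .g3 (toVec ρ t) = toVec ρ (-t) := by
  simp [toVec, Phi_g3_assemble]

theorem Phi_g3_toVec_zero (ρ : Fin 9 → ℝ) : Phi .g3 (toVec ρ 0) = toVec ρ 0 := by
  simp [Phi_g3_toVec]

theorem Phi_g3_rightKer (ρ : Fin 9 → ℝ) : Phi .g3 (rightKer ρ) = -rightKer ρ := by
  rw [rightKer, Phi_g3_assemble, ← map_neg]
  simp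

theorem leftKer_dotProduct_assemble (ρ : Fin 9 → ℝ) (e : Fin 6 → ℝ) (α t : ℝ) :
    leftKer ρ ⬝ᵥ assemble (e, α, t) = 2 * (leftCoeff ρ * α + t) := by
  simp [leftKer, dotProduct, Fin.sum_univ_succ, assemble_apply]
  ring

theorem assemble_one_ne_zero (α : ℝ) : assemble ((0 : Fin 6 → ℝ), α, 1) ≠ 0 :=
  (map_ne_zero_iff _ assemble.injective).2 (by simp)

theorem toVec_zero_add_smul_rightKer (ρ : Fin 9 → ℝ) (s : ℝ) :
    toVec ρ 0 + s • rightKer ρ = toVec ρ s := by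
  simp [toVec, rightKer, ← map_smul, ← map_add, mul_comm]

/-- `s * lineCoeff ρ (s ^ 2)` is the restriction of the function `w ⬝ᵥ F(·, m)` to the line
`x + s v`, where `v` and `w` are the kernel vectors. -/
noncomputable def lineCoeff (ρ : Fin 9 → ℝ) (T : ℝ) : ℝ :=
  2 * (leftCoeff ρ * redMap (Function.update ρ 8 T) 6 + redMap (Function.update ρ 8 T) 7)

theorem leftKer_dotProduct_dziobek_line (ρ : Fin 9 → ℝ) (s : ℝ) :
    leftKer ρ ⬝ᵥ dziobek (toVec ρ 0 + s • rightKer ρ) (ρ 7) = s * lineCoeff ρ (s ^ 2) := by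
  have := dziobek_toVec (ρ := Function.update ρ 8 (s ^ 2)) (t := s) (by simp)
  rw [toVec_update_eight, Function.update_of_ne (by decide)] at this
  rw [toVec_zero_add_smul_rightKer, this, leftKer_dotProduct_assemble, lineCoeff]
  ring

theorem leftKer_dotProduct_iteratedFDeriv (ρ : Fin 9 → ℝ) (n : ℕ) :
    leftKer ρ ⬝ᵥ iteratedFDeriv ℝ n (fun z => dziobek z (ρ 7)) (toVec ρ 0) (fun _ => rightKer ρ) =
      iteratedDeriv n (fun s => s * lineCoeff ρ (s ^ 2)) 0 := by
  simp only [← leftKer_dotProduct_dziobek_line]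
  exact map_iteratedFDeriv_const
    (LinearMap.toContinuousLinearMap (dotProductBilin ℝ ℝ (leftKer ρ)))
    ((contDiff_dziobek_left (ρ 7)).of_le (by exact_mod_cast le_top)) _ _

theorem contDiff_lineCoeff (ρ : Fin 9 → ℝ) : ContDiff ℝ ω (lineCoeff ρ) := by
  have hred (i : Fin 9) : ContDiff ℝ ω fun T => redMap (Function.update ρ 8 T) i :=
    contDiff_pi.1 (contDiff_redMap.comp (contDiff_update ω ρ 8)) i
  exact contDiff_const.mul ((contDiff_const.mul (hred 6)).add (hred 7))

theorem leftKer_dotProduct_iteratedFDeriv_two (ρ : Fin 9 → ℝ) :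
    leftKer ρ ⬝ᵥ iteratedFDeriv ℝ 2 (fun z => dziobek z (ρ 7)) (toVec ρ 0)
      ![rightKer ρ, rightKer ρ] = 0 := by
  have hconst : ![rightKer ρ, rightKer ρ] = fun _ => rightKer ρ := by
    ext i
    fin_cases i <;> rfl
  rw [hconst, leftKer_dotProduct_iteratedFDeriv]
  exact iteratedDeriv_zero_of_odd (fun s => by simp) even_two

namespace IsBifurcationPoint

theorem mem (b : IsBifurcationPoint ρ) : ρ ∈ parBox := mem_of_mem_nhds b.nhds

theorem eight (b : IsBifurcationPoint ρ) : ρ 8 = 0 := congrFun b.zero 8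

theorem dziobek_eq_zero (b : IsBifurcationPoint ρ) : dziobek (toVec ρ 0) (ρ 7) = 0 :=
  (dziobek_toVec_eq_zero_iff (by simp [b.eight])).2 (by simp [b.zero])

theorem fderiv_dziobek (b : IsBifurcationPoint ρ) (e : Fin 6 → ℝ) (α t : ℝ) :
    fderiv ℝ (fun z => dziobek z (ρ 7)) (toVec ρ 0) (assemble (e, α, t)) =
      assemble ((redJac ρ).submatrix symm symm *ᵥ e, (α - t * ρ 6) * redJac ρ 6 6,
        (α - t * ρ 6) * redJac ρ 7 6) := by
  simp [fderiv_dziobek_toVec_zero b.eight, b.zero]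

theorem ker (b : IsBifurcationPoint ρ) : LinearMap.ker (jacobian (toVec ρ 0) (ρ 7)).mulVecLin =
    Submodule.span ℝ {rightKer ρ} := by
  ext n
  obtain ⟨⟨e, α, t⟩, rfl⟩ := assemble.surjective n
  rw [LinearMap.mem_ker, Matrix.mulVecLin_apply, jacobian_mulVec, b.fderiv_dziobek,
    Submodule.mem_span_singleton, map_eq_zero_iff _ assemble.injective]
  constructor
  · intro h
    simp only [Prod.mk_eq_zero, mul_eq_zero, (redJac_six_six_pos b.mem).ne', or_false] at h
    obtain rfl := eq_zero_of_submatrix_symm_mulVec (abs_redJac_sub_le b.mem) h.1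
    refine ⟨t, ?_⟩
    rw [rightKer, ← map_smul, sub_eq_zero.1 h.2.1]
    simp
  · rintro ⟨c, hc⟩
    rw [rightKer, ← map_smul] at hc
    obtain ⟨rfl, rfl, rfl⟩ : 0 = e ∧ c * ρ 6 = α ∧ c = t := by simpa using assemble.injective hc
    simp

theorem transpose_mulVec_leftKer (b : IsBifurcationPoint ρ) :
    (jacobian (toVec ρ 0) (ρ 7))ᵀ *ᵥ leftKer ρ = 0 := by
  refine dotProduct_eq_zero _ fun n => ?_
  obtain ⟨⟨e, α, t⟩, rfl⟩ := assemble.surjective n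
  rw [Matrix.mulVec_transpose, ← Matrix.dotProduct_mulVec, jacobian_mulVec, b.fderiv_dziobek,
    leftKer_dotProduct_assemble]
  linear_combination 2 * (α - t * ρ 6) * leftCoeff_mul b.mem

theorem leftKer_dotProduct_deriv (b : IsBifurcationPoint ρ) :
    leftKer ρ ⬝ᵥ deriv (fun μ => dziobek (toVec ρ 0) μ) (ρ 7) = 0 := by
  have heq (μ : ℝ) : dziobek (toVec ρ 0) μ =
      assemble (redMap (Function.update ρ 7 μ) ∘ symm, 0, 0) := by
    have := dziobek_toVec (ρ := Function.update ρ 7 μ) (t := 0) (by simp [b.eight])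
    simpa [toVec_update_seven] using this
  have hderiv : HasDerivAt (fun μ => dziobek (toVec ρ 0) μ)
      (assemble (fun i => redJac ρ (symm i) 7, 0, 0)) (ρ 7) := by
    simp only [heq]
    exact assemble.toContinuousLinearMap.hasFDerivAt.comp_hasDerivAt (ρ 7)
      ((hasDerivAt_pi.2 fun i => hasDerivAt_redMap_update ρ 7 (symm i)).prodMk
        (hasDerivAt_const (ρ 7) 0))
  rw [hderiv.deriv, leftKer_dotProduct_assemble]
  simp

theorem leftKer_dotProduct_deriv_fderiv (b : IsBifurcationPoint ρ) :
    leftKer ρ ⬝ᵥ deriv (fun μ => fderiv ℝ (fun z => dziobek z μ) (toVec ρ 0) (rightKer ρ)) (ρ 7) =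
      2 * (leftCoeff ρ * redJac ρ 6 7 + redJac ρ 7 7) := by
  have heq (μ : ℝ) : fderiv ℝ (fun z => dziobek z μ) (toVec ρ 0) (rightKer ρ) =
      assemble (0, redMap (Function.update ρ 7 μ) 6, redMap (Function.update ρ 7 μ) 7) := by
    have := fderiv_dziobek_toVec (ρ := Function.update ρ 7 μ) (σ := 0) (t := 0) (t' := 1)
      (by simp [b.eight]) rfl (by simp)
    simpa [toVec_update_seven, rightKer] using this
  have hderiv : HasDerivAt (fun μ => fderiv ℝ (fun z => dziobek z μ) (toVec ρ 0) (rightKer ρ))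
      (assemble (0, redJac ρ 6 7, redJac ρ 7 7)) (ρ 7) := by
    simp only [heq]
    exact assemble.toContinuousLinearMap.hasFDerivAt.comp_hasDerivAt (ρ 7)
      ((hasDerivAt_const (ρ 7) 0).prodMk
        ((hasDerivAt_redMap_update ρ 7 6).prodMk (hasDerivAt_redMap_update ρ 7 7)))
  rw [hderiv.deriv, leftKer_dotProduct_assemble]

theorem leftKer_dotProduct_iteratedFDeriv_three (b : IsBifurcationPoint ρ) :
    leftKer ρ ⬝ᵥ iteratedFDeriv ℝ 3 (fun z => dziobek z (ρ 7)) (toVec ρ 0)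
      ![rightKer ρ, rightKer ρ, rightKer ρ] =
      12 * (leftCoeff ρ * redJac ρ 6 8 + redJac ρ 7 8) := by
  have hconst : ![rightKer ρ, rightKer ρ, rightKer ρ] = fun _ => rightKer ρ := by
    ext i
    fin_cases i <;> rfl
  have hderiv : HasDerivAt (lineCoeff ρ) (2 * (leftCoeff ρ * redJac ρ 6 8 + redJac ρ 7 8)) 0 := by
    have hred (i : Fin 9) := b.eight ▸ hasDerivAt_redMap_update ρ 8 i
    exact (((hred 6).const_mul _).add (hred 7)).const_mul 2
  rw [hconst, leftKer_dotProduct_iteratedFDeriv, iteratedDeriv_three_mul_comp_sq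
    ((contDiff_lineCoeff ρ).of_le (by exact_mod_cast le_top)).contDiffAt, hderiv.deriv]
  ring

theorem pitchforkConditions (b : IsBifurcationPoint ρ) :
    PitchforkConditions .g3 (toVec ρ 0) (ρ 7) (rightKer ρ) (leftKer ρ) where
  v_ne := assemble_one_ne_zero _
  w_ne := assemble_one_ne_zero _
  ker := b.ker
  coker := ker_transpose_mulVecLin_eq_span b.ker (assemble_one_ne_zero _)
    b.transpose_mulVec_leftKer (assemble_one_ne_zero _)
  fix := Phi_g3_toVec_zero ρ
  anti := Phi_g3_rightKer ρ
  first := b.leftKer_dotProduct_deriv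
  mixed := by
    rw [b.leftKer_dotProduct_deriv_fderiv]
    exact mul_pos two_pos (leftCoeff_mul_redJac_seven_pos b.mem)
  second := leftKer_dotProduct_iteratedFDeriv_two ρ
  third := by
    rw [b.leftKer_dotProduct_iteratedFDeriv_three]
    exact mul_neg_of_pos_of_neg (by norm_num) (leftCoeff_mul_redJac_eight_neg b.mem)

end IsBifurcationPoint

end Conditions

/-! ## Pitchforks from parametrized branches -/

theorem exists_contDiffAt_rightInverse {E : Type*} [NormedAddCommGroup E] [NormedSpace ℝ E]
    [FiniteDimensional ℝ E] {n : WithTop ℕ∞} {f : E → E} {f' : E →L[ℝ] E} {a : E}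
    (hf : ContDiffAt ℝ n f a) (hn : n ≠ 0) (hf' : HasFDerivAt f f' a)
    (hinj : Function.Injective f') :
    ∃ g : E → E, ContDiffAt ℝ n g (f a) ∧ g (f a) = a ∧ ∀ᶠ y in 𝓝 (f a), f (g y) = y := by
  have := FiniteDimensional.complete ℝ E
  let e : E ≃L[ℝ] E := (LinearEquiv.ofInjectiveEndo f'.toLinearMap hinj).toContinuousLinearEquiv
  have he : HasFDerivAt f (e : E →L[ℝ] E) a := hf'
  exact ⟨hf.localInverse he hn, hf.to_localInverse he hn, hf.localInverse_apply_image he hn,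
    (hf.hasStrictFDerivAt' he hn).eventually_right_inverse⟩

theorem eventually_strictMonoOn_Ico_of_deriv_deriv_pos {τ : ℝ → ℝ}
    (hτ : ∀ᶠ t in 𝓝 0, DifferentiableAt ℝ τ t) (hderiv : deriv τ 0 = 0)
    (hbend : 0 < deriv (deriv τ) 0) : ∀ᶠ δ in 𝓝[>] 0, StrictMonoOn τ (Set.Ico 0 δ) := by
  have hsign := eventually_nhdsWithin_sign_eq_of_deriv_pos hbend hderiv
  obtain ⟨r, hr, hball⟩ := Metric.eventually_nhds_iff_ball.1 (hτ.and hsign)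
  filter_upwards [Ioo_mem_nhdsGT hr] with δ hδ
  have hIco (t : ℝ) (ht : t ∈ Set.Ico 0 δ) : t ∈ Metric.ball (0 : ℝ) r := by
    simpa [abs_of_nonneg ht.1] using ht.2.trans hδ.2
  refine strictMonoOn_of_deriv_pos (convex_Ico 0 δ)
    (fun t ht => (hball t (hIco t ht)).1.continuousAt.continuousWithinAt) fun t ht => ?_
  rw [interior_Ico] at ht
  rw [← sign_eq_one_iff, (hball t (hIco t (Set.Ioo_subset_Ico_self ht))).2, sub_zero, sign_pos ht.1]

theorem eventually_forall_Ioo {p : ℝ → Prop} {a : ℝ} (h : ∀ᶠ x in 𝓝 a, p x) :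
    ∀ᶠ r in 𝓝[>] 0, ∀ x ∈ Set.Ioo (a - r) (a + r), p x := by
  obtain ⟨r, hr, hball⟩ := Metric.eventually_nhds_iff_ball.1 h
  filter_upwards [Ioo_mem_nhdsGT hr] with s hs x hx
  exact hball x (Metric.ball_subset_ball hs.2.le (Real.ball_eq_Ioo a s ▸ hx))

section EvenFunction

variable {τ : ℝ → ℝ} {δ μ : ℝ}

theorem setOf_even_eq_empty (hτ : Function.Even τ) (hmono : StrictMonoOn τ (Set.Ico 0 δ))
    (hμ : μ ≤ τ 0) : {t ∈ Set.Ioo (-δ) δ | t ≠ 0 ∧ τ t = μ} = ∅ := by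
  refine Set.eq_empty_of_forall_notMem ?_
  rintro t ⟨ht, ht0, rfl⟩
  have habs : |t| ∈ Set.Ico 0 δ := ⟨abs_nonneg t, abs_lt.2 ht⟩
  have hlt := hmono ⟨le_rfl, habs.1.trans_lt habs.2⟩ habs (abs_pos.2 ht0)
  rcases abs_choice t with h | h <;> rw [h] at hlt
  · exact hlt.not_ge hμ
  · exact hlt.not_ge (hτ t ▸ hμ)

theorem setOf_even_eq_pair (hτ : Function.Even τ) (hmono : StrictMonoOn τ (Set.Ico 0 δ)) {t : ℝ}
    (ht : t ∈ Set.Ioo 0 δ) : {s ∈ Set.Ioo (-δ) δ | s ≠ 0 ∧ τ s = τ t} = {-t, t} := by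
  ext s
  simp only [Set.mem_ofPred_eq, Set.mem_insert_iff, Set.mem_singleton_iff]
  constructor
  · rintro ⟨hs, -, heq⟩
    have habs : τ |s| = τ t := by
      rcases abs_choice s with h | h <;> rw [h]
      exacts [heq, (hτ s).trans heq]
    have := hmono.injOn ⟨abs_nonneg s, abs_lt.2 hs⟩ (Set.Ioo_subset_Ico_self ht) habs
    exact (eq_or_eq_neg_of_abs_eq this).symm
  · rintro (rfl | rfl)
    · exact ⟨⟨by linarith [ht.2], by linarith [ht.1, ht.2]⟩, by linarith [ht.1], hτ t⟩
    · exact ⟨⟨by linarith [ht.1, ht.2], ht.2⟩, ht.1.ne', rfl⟩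

end EvenFunction

/-- Two branches of zeros of `F` through `(x₀, μ₀)`, which together contain all zeros nearby: the
graph of `s`, and the curve `(y, τ)`, which is an even function of the parameter in its second
component. The function `ℓ` vanishes on the first branch and is the parameter of the second. -/
structure IsPitchforkPair {E : Type*} [NormedAddCommGroup E] [NormedSpace ℝ E]
    (F : E → ℝ → E) (ℓ : E → ℝ) (x₀ : E) (μ₀ : ℝ) (s y : ℝ → E) (τ : ℝ → ℝ) : Prop where
  continuous_param : Continuous ℓ
  s_smooth : ContDiffAt ℝ ω s μ₀
  y_smooth : ContDiffAt ℝ ω y 0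
  τ_smooth : ContDiffAt ℝ ω τ 0
  s_base : s μ₀ = x₀
  y_base : y 0 = x₀
  τ_base : τ 0 = μ₀
  y_tangent : deriv y 0 ≠ 0
  τ_even : Function.Even τ
  τ_bend : 0 < deriv (deriv τ) 0
  param_s : ∀ᶠ μ in 𝓝 μ₀, ℓ (s μ) = 0
  param_y : ∀ t, ℓ (y t) = t
  s_zero : ∀ᶠ μ in 𝓝 μ₀, F (s μ) μ = 0
  y_zero : ∀ᶠ t in 𝓝 0, F (y t) (τ t) = 0
  complete : ∀ᶠ p in 𝓝 (x₀, μ₀), F p.1 p.2 = 0 →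
    p.1 = s p.2 ∨ ℓ p.1 ≠ 0 ∧ p.1 = y (ℓ p.1) ∧ p.2 = τ (ℓ p.1)

namespace IsPitchforkPair

variable {E : Type*} [NormedAddCommGroup E] [NormedSpace ℝ E] {F : E → ℝ → E} {ℓ : E → ℝ}
  {x₀ : E} {μ₀ : ℝ} {s y : ℝ → E} {τ : ℝ → ℝ}

theorem τ_tangent (h : IsPitchforkPair F ℓ x₀ μ₀ s y τ) : deriv τ 0 = 0 := by
  have := deriv_comp_neg τ 0
  rw [funext h.τ_even, neg_zero] at this
  exact self_eq_neg.1 this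

/-- The neighbourhood `W` and the intervals of radius `ε` and `δ` isolate the branches `s` and
`(y, τ)`: there the branches are smooth, contain all zeros, and `τ` is monotone on each half. -/
structure IsIsolating (F : E → ℝ → E) (ℓ : E → ℝ) (μ₀ : ℝ) (s y : ℝ → E) (τ : ℝ → ℝ)
    (W : Set E) (ε δ : ℝ) : Prop where
  isOpen : IsOpen W
  ε_pos : 0 < ε
  δ_pos : 0 < δ
  param_mem : ∀ x ∈ W, ℓ x ∈ Set.Ioo (-δ) δ
  s_smooth : ∀ μ ∈ Set.Ioo (μ₀ - ε) (μ₀ + ε), ContDiffAt ℝ ω s μ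
  y_smooth : ∀ t ∈ Set.Ioo (-δ) δ, ContDiffAt ℝ ω y t
  τ_smooth : ∀ t ∈ Set.Ioo (-δ) δ, ContDiffAt ℝ ω τ t
  strictMonoOn : StrictMonoOn τ (Set.Ico 0 δ)
  lt_half : ∀ μ ∈ Set.Ioo (μ₀ - ε) (μ₀ + ε), μ < τ (δ / 2)
  param_s : ∀ μ ∈ Set.Ioo (μ₀ - ε) (μ₀ + ε), ℓ (s μ) = 0
  s_zero : ∀ μ ∈ Set.Ioo (μ₀ - ε) (μ₀ + ε), s μ ∈ W ∧ F (s μ) μ = 0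
  y_zero : ∀ t ∈ Set.Ioo (-δ) δ, y t ∈ W ∧ F (y t) (τ t) = 0
  complete : ∀ μ ∈ Set.Ioo (μ₀ - ε) (μ₀ + ε), ∀ x ∈ W, F x μ = 0 →
    x = s μ ∨ ℓ x ≠ 0 ∧ x = y (ℓ x) ∧ μ = τ (ℓ x)

variable {W : Set E} {ε δ μ : ℝ}

theorem IsIsolating.zeros_eq (h : IsIsolating F ℓ μ₀ s y τ W ε δ)
    (hμ : μ ∈ Set.Ioo (μ₀ - ε) (μ₀ + ε)) :
    {x ∈ W | F x μ = 0} = insert (s μ) (y '' {t ∈ Set.Ioo (-δ) δ | t ≠ 0 ∧ τ t = μ}) := by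
  refine Set.Subset.antisymm ?_ (Set.insert_subset (h.s_zero μ hμ) ?_)
  · rintro x ⟨hx, hzero⟩
    refine (h.complete μ hμ x hx hzero).imp_right ?_
    rintro ⟨hℓ, hxy, heq⟩
    exact ⟨ℓ x, ⟨h.param_mem x hx, hℓ, heq.symm⟩, hxy.symm⟩
  · rintro _ ⟨t, ⟨ht, -, rfl⟩, rfl⟩
    exact h.y_zero t ht

theorem IsIsolating.exists_eq (h : IsIsolating F ℓ μ₀ s y τ W ε δ)
    (hμ : μ ∈ Set.Ioo (μ₀ - ε) (μ₀ + ε)) (hlt : τ 0 < μ) : ∃ t ∈ Set.Ioo 0 δ, τ t = μ := by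
  have hhalf := half_pos h.δ_pos
  have hcont : ContinuousOn τ (Set.Icc 0 (δ / 2)) := fun t ht =>
    (h.τ_smooth t ⟨by linarith [ht.1], by linarith [ht.2]⟩).continuousAt.continuousWithinAt
  obtain ⟨t, ht, heq⟩ := intermediate_value_Ioo hhalf.le hcont ⟨hlt, h.lt_half μ hμ⟩
  exact ⟨t, ⟨ht.1, by linarith [ht.2]⟩, heq⟩

theorem ncard_triple (h : IsPitchforkPair F ℓ x₀ μ₀ s y τ) {t : ℝ} (hs : ℓ (s μ) = 0)
    (ht : 0 < t) : ({s μ, y (-t), y t} : Set E).ncard = 3 := by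
  have hne {x x' : E} (hℓ : ℓ x ≠ ℓ x') : x ≠ x' := fun heq => hℓ (congrArg ℓ heq)
  refine Set.ncard_eq_three.2 ⟨_, _, _, hne ?_, hne ?_, hne ?_, rfl⟩ <;>
  · simp only [hs, h.param_y]
    linarith

theorem isSupercriticalPitchfork (h : IsPitchforkPair F ℓ x₀ μ₀ s y τ)
    (hW : IsIsolating F ℓ μ₀ s y τ W ε δ) : IsSupercriticalPitchfork F x₀ μ₀ W ε δ s y τ where
  isOpen := hW.isOpen
  mem := h.y_base ▸ (hW.y_zero 0 (by simpa using hW.δ_pos)).1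
  ε_pos := hW.ε_pos
  δ_pos := hW.δ_pos
  s_smooth μ hμ := ((hW.s_smooth μ hμ).of_le (by simp)).contDiffWithinAt
  s_base := h.s_base
  y_smooth t ht := ((hW.y_smooth t ht).of_le (by simp)).contDiffWithinAt
  τ_smooth t ht := ((hW.τ_smooth t ht).of_le (by simp)).contDiffWithinAt
  y_base := h.y_base
  τ_base := h.τ_base
  y_tangent := h.y_tangent
  τ_tangent := h.τ_tangent
  τ_bend := h.τ_bend
  y_zero := hW.y_zero
  below μ hμ := by
    rw [hW.zeros_eq ⟨hμ.1, by linarith [hμ.2, hW.ε_pos]⟩,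
      setOf_even_eq_empty h.τ_even hW.strictMonoOn (hμ.2.trans_eq h.τ_base.symm),
      Set.image_empty, insert_empty_eq]
  above μ hμ := by
    have hμ' : μ ∈ Set.Ioo (μ₀ - ε) (μ₀ + ε) := ⟨by linarith [hμ.1, hW.ε_pos], hμ.2⟩
    obtain ⟨t, ht, rfl⟩ := hW.exists_eq hμ' (h.τ_base.symm ▸ hμ.1)
    have hzeros := hW.zeros_eq hμ'
    rw [setOf_even_eq_pair h.τ_even hW.strictMonoOn ht, Set.image_pair] at hzeros
    exact ⟨-t, ⟨neg_lt_neg ht.2, neg_lt_zero.2 ht.1⟩, t, ht, h.τ_even t, rfl, hzeros,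
      hzeros ▸ h.ncard_triple (hW.param_s _ hμ') ht.1⟩

theorem exists_curve_radius (h : IsPitchforkPair F ℓ x₀ μ₀ s y τ) {U : Set E} (hU : U ∈ 𝓝 x₀) :
    ∃ δ > 0, StrictMonoOn τ (Set.Ico 0 δ) ∧ ∀ t ∈ Set.Ioo (-δ) δ,
      y t ∈ U ∧ F (y t) (τ t) = 0 ∧ ContDiffAt ℝ ω y t ∧ ContDiffAt ℝ ω τ t := by
  have hyU : ∀ᶠ t in 𝓝 0, y t ∈ U := h.y_smooth.continuousAt.eventually (h.y_base.symm ▸ hU)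
  have hτ_smooth := h.τ_smooth.eventually (by simp)
  have hmono := eventually_strictMonoOn_Ico_of_deriv_deriv_pos
    (hτ_smooth.mono fun t ht => ht.differentiableAt (by simp)) h.τ_tangent h.τ_bend
  obtain ⟨δ, ⟨hδ_mono, hy⟩, hδ⟩ := ((hmono.and (eventually_forall_Ioo (hyU.and
    (h.y_zero.and ((h.y_smooth.eventually (by simp)).and hτ_smooth))))).and
      self_mem_nhdsWithin).exists
  exact ⟨δ, hδ, hδ_mono, by simpa only [zero_sub, zero_add] using hy⟩

theorem exists_isIsolating (h : IsPitchforkPair F ℓ x₀ μ₀ s y τ) {V : Set E} (hV : V ∈ 𝓝 x₀) :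
    ∃ W ⊆ V, ∃ ε δ, IsIsolating F ℓ μ₀ s y τ W ε δ := by
  obtain ⟨U, J, hU, hxU, hJ, hμJ, hUJ⟩ := mem_nhds_prod_iff'.1
    (Filter.inter_mem (prod_mem_nhds hV Filter.univ_mem) h.complete)
  obtain ⟨δ, hδ, hδ_mono, hy⟩ := h.exists_curve_radius (hU.mem_nhds hxU)
  simp only [forall_and] at hy
  obtain ⟨hyU, hy_zero, hy_smooth, hτ_smooth⟩ := hy
  have hsU : ∀ᶠ μ in 𝓝 μ₀, s μ ∈ U :=
    h.s_smooth.continuousAt.eventually (hU.mem_nhds (h.s_base.symm ▸ hxU))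
  have hlt : μ₀ < τ (δ / 2) :=
    h.τ_base ▸ hδ_mono ⟨le_rfl, hδ⟩ ⟨half_pos hδ |>.le, half_lt_self hδ⟩ (half_pos hδ)
  obtain ⟨ε, hs, hε : 0 < ε⟩ := ((eventually_forall_Ioo (hsU.and (h.s_zero.and (h.param_s.and
    ((h.s_smooth.eventually (by simp)).and ((hJ.eventually_mem hμJ).and
      (eventually_lt_nhds hlt))))))).and self_mem_nhdsWithin).exists
  simp only [forall_and] at hs
  obtain ⟨hsU, hs_zero, hs_param, hs_smooth, hsJ, hs_lt⟩ := hs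
  exact ⟨U ∩ ℓ ⁻¹' Set.Ioo (-δ) δ, fun x hx => (@hUJ (x, μ₀) ⟨hx.1, hμJ⟩).1.1, ε, δ,
    { isOpen := hU.inter (isOpen_Ioo.preimage h.continuous_param)
      ε_pos := hε
      δ_pos := hδ
      param_mem := fun x hx => hx.2
      s_smooth := hs_smooth
      y_smooth := hy_smooth
      τ_smooth := hτ_smooth
      strictMonoOn := hδ_mono
      lt_half := hs_lt
      param_s := hs_param
      s_zero := fun μ hμ => ⟨⟨hsU μ hμ, by simp [hs_param μ hμ, hδ]⟩, hs_zero μ hμ⟩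
      y_zero := fun t ht => ⟨⟨hyU t ht, by simpa [h.param_y] using ht⟩, hy_zero t ht⟩
      complete := fun μ hμ x hx => (@hUJ (x, μ) ⟨hx.1, hsJ μ hμ⟩).2 }⟩

end IsPitchforkPair

theorem contDiff_toVec : ContDiff ℝ ω fun p : (Fin 9 → ℝ) × ℝ => toVec p.1 p.2 :=
  assemble.contDiff.comp (by fun_prop :
    ContDiff ℝ ω fun p : (Fin 9 → ℝ) × ℝ => (p.1 ∘ symm, p.1 6 * p.2, p.2))

theorem eq_of_skew_eq_zero {x y : Vec} {m : ℝ} (hx : x ∈ vecBox) (hy : y ∈ vecBox)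
    (hm : m ∈ massBox) (hx_zero : dziobek x m = 0) (hy_zero : dziobek y m = 0)
    (hx_skew : skew x = 0) (hy_skew : skew y = 0) : x = y := by
  obtain ⟨ρ, hρ, hρ₆, rfl, hρ₈, rfl, hρ_zero⟩ :=
    exists_redMap_comp_symm_eq_zero hx hm hx_zero hx_skew
  obtain ⟨σ, hσ, hσ₆, hσ₇, hσ₈, rfl, hσ_zero⟩ :=
    exists_redMap_comp_symm_eq_zero hy hm hy_zero hy_skew
  obtain ⟨J, hJ, hsub⟩ := exists_redMap_sub_eq hρ hσ
  have hdiff : ρ - σ = ofParts ((ρ - σ) ∘ symm) 0 0 0 := by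
    simp [eq_iff_comp_symm, hρ₆, hσ₆, hσ₇, hρ₈, hσ₈]
  have hzero : J.submatrix symm symm *ᵥ ((ρ - σ) ∘ symm) = 0 := by
    rw [← mulVec_ofParts_comp_symm, ← hdiff, ← hsub]
    exact sub_eq_zero.2 (hρ_zero.trans hσ_zero.symm)
  have hsymm : ρ ∘ symm = σ ∘ symm := sub_eq_zero.1 (eq_zero_of_submatrix_symm_mulVec hJ hzero)
  rw [eq_iff_comp_symm.2 ⟨hsymm, hρ₆.trans hσ₆.symm, hσ₇.symm, hρ₈.trans hσ₈.symm⟩]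

/-- The equations for symmetric solutions with the trivial equations for the other three
unknowns, so that the symmetric solutions are parametrized by the mass. -/
def symmReduced : Fin 9 → PolyExpr (Fin 9) :=
  Function.update (Function.update reduced 6 (X 6)) 7 (X 7)

theorem polyMap_symmReduced (ρ : Fin 9 → ℝ) :
    polyMap symmReduced ρ = ofParts (redMap ρ ∘ symm) (ρ 6) (ρ 7) (ρ 8) := by
  ext i
  fin_cases i <;> rfl

theorem polyJac_symmReduced_mulVec (ρ u : Fin 9 → ℝ) :
    polyJac symmReduced ρ *ᵥ u = ofParts ((redJac ρ *ᵥ u) ∘ symm) (u 6) (u 7) (u 8) := by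
  have hunit (j : Fin 9) (h : symmReduced j = X j) : (polyJac symmReduced ρ *ᵥ u) j = u j := by
    simp [polyJac, Matrix.mulVec, dotProduct, h, eval_pderiv_var]
  refine eq_iff_comp_symm.2 ⟨?_, hunit 6 rfl, hunit 7 rfl, hunit 8 rfl⟩
  ext i
  fin_cases i <;> rfl

theorem dziobek_toVec_eq_zero {ρ : Fin 9 → ℝ} {t : ℝ} (h : redMap ρ = Pi.single 8 (t ^ 2)) :
    dziobek (toVec ρ t) (ρ 7) = 0 := by
  obtain ⟨hsymm, h6, h7, h8⟩ := redMap_eq_single_iff.1 h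
  exact (dziobek_toVec_eq_zero_iff h8).2 ⟨hsymm, by simp [h6], by simp [h7]⟩

theorem deriv_toVec_comp_sq {γ : ℝ → Fin 9 → ℝ} (hγ : DifferentiableAt ℝ γ 0) :
    deriv (fun t => toVec (γ (t ^ 2)) t) 0 = rightKer (γ 0) := by
  have hsq : HasDerivAt (fun t : ℝ => t ^ 2) 0 0 := by simpa using hasDerivAt_pow 2 (0 : ℝ)
  have hγ_sq : HasDerivAt (fun t : ℝ => γ (t ^ 2)) 0 0 := by
    rw [← zero_smul ℝ (deriv γ 0)]
    exact HasDerivAt.scomp_of_eq 0 hγ.hasDerivAt hsq (by simp)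
  rw [(hasDerivAt_toVec hγ_sq (hasDerivAt_id' 0)).deriv, rightKer]
  simp

namespace IsBifurcationPoint

variable {ρ : Fin 9 → ℝ}

theorem exists_curve (b : IsBifurcationPoint ρ) : ∃ γ : ℝ → Fin 9 → ℝ,
    ContDiffAt ℝ ω γ 0 ∧ γ 0 = ρ ∧ ∀ᶠ T in 𝓝 0, redMap (γ T) = Pi.single 8 T := by
  have hinj : Function.Injective (redJac ρ).mulVecLin :=
    (injective_iff_map_eq_zero _).2 fun u hu =>
      isApproxInverse_approxInv.eq_zero_of_mulVec_eq_zero (by norm_num) (abs_redJac_sub_le b.mem) hu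
  obtain ⟨g, hg, hgρ, hright⟩ := exists_contDiffAt_rightInverse contDiff_redMap.contDiffAt
    (by simp) (hasFDerivAt_redMap ρ) hinj
  rw [b.zero] at hg hgρ hright
  have hline : ContDiff ℝ ω fun T : ℝ => (Pi.single 8 T : Fin 9 → ℝ) :=
    contDiff_single (F' := fun _ : Fin 9 => ℝ) ω 8
  have hline_zero : (Pi.single 8 0 : Fin 9 → ℝ) = 0 := Pi.single_zero 8
  refine ⟨fun T => g (Pi.single 8 T), ContDiffAt.comp 0 (by rwa [hline_zero]) hline.contDiffAt,
    by simpa only [hline_zero], ?_⟩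
  exact hline.continuous.continuousAt.eventually (f := fun T => Pi.single 8 T)
    (p := fun y => redMap (g y) = y) (by simpa only [hline_zero] using hright)

theorem exists_symmCurve (b : IsBifurcationPoint ρ) : ∃ η : ℝ → Fin 9 → ℝ,
    ContDiffAt ℝ ω η (ρ 7) ∧ η (ρ 7) = ρ ∧
      ∀ᶠ μ in 𝓝 (ρ 7), redMap (η μ) ∘ symm = 0 ∧ η μ 7 = μ ∧ η μ 8 = 0 := by
  have hinj : Function.Injective (polyJac symmReduced ρ).mulVecLin := by
    refine (injective_iff_map_eq_zero _).2 fun u hu => ?_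
    rw [Matrix.mulVecLin_apply, polyJac_symmReduced_mulVec, eq_iff_comp_symm] at hu
    simp only [ofParts_comp_symm, ofParts_six, ofParts_seven, ofParts_eight] at hu
    obtain ⟨hsymm, h6, h7, h8⟩ := hu
    have hu : u = ofParts (u ∘ symm) 0 0 0 := by simp [eq_iff_comp_symm, h6, h7, h8]
    rw [hu, mulVec_ofParts_comp_symm] at hsymm
    rw [hu, eq_zero_of_submatrix_symm_mulVec (abs_redJac_sub_le b.mem) hsymm]
    simp [eq_iff_comp_symm]
  obtain ⟨g, hg, hgρ, hright⟩ := exists_contDiffAt_rightInverse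
    (contDiff_polyMap symmReduced).contDiffAt (by simp) (hasFDerivAt_polyMap symmReduced ρ) hinj
  have hline : ContDiff ℝ ω fun μ : ℝ => ofParts 0 (ρ 6) μ 0 := by
    unfold ofParts
    exact contDiff_pi.2 fun i => by fin_cases i <;> first | exact contDiff_const | exact contDiff_id
  have hbase : polyMap symmReduced ρ = ofParts 0 (ρ 6) (ρ 7) 0 := by
    rw [polyMap_symmReduced, b.zero, b.eight]
    rfl
  rw [hbase] at hg hgρ hright
  refine ⟨fun μ => g (ofParts 0 (ρ 6) μ 0), hg.comp (ρ 7) hline.contDiffAt, hgρ, ?_⟩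
  filter_upwards [hline.continuous.continuousAt.eventually hright] with μ hμ
  rw [polyMap_symmReduced, eq_iff_comp_symm] at hμ
  simp only [ofParts_comp_symm, ofParts_six, ofParts_seven, ofParts_eight] at hμ
  exact ⟨hμ.1, hμ.2.2⟩

theorem deriv_apply_seven_pos (b : IsBifurcationPoint ρ) {γ : ℝ → Fin 9 → ℝ}
    (hγ : ContDiffAt ℝ ω γ 0) (hγ_zero : γ 0 = ρ)
    (hred : ∀ᶠ T in 𝓝 0, redMap (γ T) = Pi.single 8 T) : 0 < deriv (fun T => γ T 7) 0 := by
  have hderiv := (hγ.differentiableAt (by simp)).hasDerivAt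
  have hline : HasDerivAt (fun T : ℝ => (Pi.single 8 T : Fin 9 → ℝ)) (Pi.single 8 1) 0 :=
    hasDerivAt_single 8 0
  have hchain := (hasFDerivAt_redMap (γ 0)).comp_hasDerivAt 0 hderiv
  have hmul : redJac ρ *ᵥ deriv γ 0 = Pi.single 8 1 := by
    rw [← hγ_zero]
    exact (hchain.congr_of_eventuallyEq (hred.mono fun T hT => hT.symm)).unique hline
  have hspeed := (abs_le.1 (abs_apply_seven_sub_le (abs_redJac_sub_le b.mem) hmul)).1
  rw [(hasDerivAt_pi.1 hderiv 7).deriv]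
  norm_num at hspeed
  linarith

theorem eventually_eq_or_eq (b : IsBifurcationPoint ρ) {γ η : ℝ → Fin 9 → ℝ}
    (hγ : ContinuousAt γ 0) (hγ_zero : γ 0 = ρ)
    (hγ_red : ∀ᶠ T in 𝓝 0, redMap (γ T) = Pi.single 8 T)
    (hη : ∀ᶠ μ in 𝓝 (ρ 7), toVec (η μ) 0 ∈ vecBox ∧ dziobek (toVec (η μ) 0) μ = 0) :
    ∀ᶠ p in 𝓝 (toVec ρ 0, ρ 7), dziobek p.1 p.2 = 0 →
      p.1 = toVec (η p.2) 0 ∨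
        skew p.1 ≠ 0 ∧ p.1 = toVec (γ (skew p.1 ^ 2)) (skew p.1) ∧ p.2 = γ (skew p.1 ^ 2) 7 := by
  have hbox : ∀ᶠ p in 𝓝 (toVec ρ 0, ρ 7), p.1 ∈ vecBox ∧ p.2 ∈ massBox :=
    prod_mem_nhds (isOpen_vecBox.mem_nhds b.vec) (Metric.isOpen_ball.mem_nhds b.mass)
  have hskew : Filter.Tendsto (fun p : Vec × ℝ => skew p.1 ^ 2) (𝓝 (toVec ρ 0, ρ 7)) (𝓝 0) :=
    Continuous.tendsto' ((continuous_skew.comp continuous_fst).pow 2) _ _ (by simp)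
  have hγ_box : ∀ᶠ T in 𝓝 0, γ T ∈ parBox := hγ (hγ_zero.symm ▸ b.nhds)
  filter_upwards [hbox, hskew.eventually (hγ_box.and hγ_red),
    continuousAt_snd.eventually hη] with p hp hγp hηp hzero
  by_cases hs : skew p.1 = 0
  · exact Or.inl (eq_of_skew_eq_zero hp.1 hηp.1 hp.2 hzero hηp.2 hs (skew_toVec _ _))
  · obtain ⟨σ, hσ, hσ₇, hσ_vec, hσ_red⟩ := exists_redMap_eq_single hp.1 hp.2 hzero hs
    have hσγ := injOn_redMap hσ hγp.1 (hσ_red.trans hγp.2.symm)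
    exact Or.inr ⟨hs, hσγ ▸ hσ_vec.symm, hσγ ▸ hσ₇.symm⟩

theorem isPitchforkPair (b : IsBifurcationPoint ρ) {γ η : ℝ → Fin 9 → ℝ}
    (hγ : ContDiffAt ℝ ω γ 0) (hγ_zero : γ 0 = ρ)
    (hγ_red : ∀ᶠ T in 𝓝 0, redMap (γ T) = Pi.single 8 T)
    (hη : ContDiffAt ℝ ω η (ρ 7)) (hη_base : η (ρ 7) = ρ)
    (hη_red : ∀ᶠ μ in 𝓝 (ρ 7), redMap (η μ) ∘ symm = 0 ∧ η μ 7 = μ ∧ η μ 8 = 0) :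
    IsPitchforkPair dziobek skew (toVec ρ 0) (ρ 7) (fun μ => toVec (η μ) 0)
      (fun t => toVec (γ (t ^ 2)) t) (fun t => γ (t ^ 2) 7) := by
  have hγ_sq : ContDiffAt ℝ ω (fun t : ℝ => γ (t ^ 2)) 0 :=
    ContDiffAt.comp 0 (by simpa using hγ) (by fun_prop)
  have hη_smooth : ContDiffAt ℝ ω (fun μ => toVec (η μ) 0) (ρ 7) :=
    contDiff_toVec.contDiffAt.comp (ρ 7) (hη.prodMk contDiffAt_const)
  have hη_zero : ∀ᶠ μ in 𝓝 (ρ 7), dziobek (toVec (η μ) 0) μ = 0 := hη_red.mono fun μ hμ => by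
    have := (dziobek_toVec_eq_zero_iff (t := 0) (by simp [hμ.2.2])).2 ⟨hμ.1, by simp⟩
    rwa [hμ.2.1] at this
  have hsq : Filter.Tendsto (fun t : ℝ => t ^ 2) (𝓝 0) (𝓝 0) :=
    Continuous.tendsto' (by fun_prop) _ _ (by simp)
  have hη_box : ∀ᶠ μ in 𝓝 (ρ 7), toVec (η μ) 0 ∈ vecBox :=
    hη_smooth.continuousAt.eventually
      (isOpen_vecBox.mem_nhds (by simpa only [hη_base] using b.vec))
  exact
    { continuous_param := continuous_skew
      s_smooth := hη_smooth
      y_smooth := contDiff_toVec.contDiffAt.comp 0 (hγ_sq.prodMk contDiffAt_id)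
      τ_smooth := contDiffAt_pi.1 hγ_sq 7
      s_base := by rw [hη_base]
      y_base := by simp [hγ_zero]
      τ_base := by simp [hγ_zero]
      y_tangent := by
        rw [deriv_toVec_comp_sq (hγ.differentiableAt (by simp)), hγ_zero]
        exact assemble_one_ne_zero _
      τ_even := fun t => by simp
      τ_bend := by
        rw [deriv_deriv_comp_sq ((contDiffAt_pi.1 hγ 7).of_le (by exact_mod_cast le_top))]
        exact mul_pos two_pos (b.deriv_apply_seven_pos hγ hγ_zero hγ_red)
      param_s := Filter.Eventually.of_forall fun μ => skew_toVec _ _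
      param_y := fun t => skew_toVec _ _
      s_zero := hη_zero
      y_zero := (hsq.eventually hγ_red).mono fun t => dziobek_toVec_eq_zero
      complete := b.eventually_eq_or_eq hγ.continuousAt hγ_zero hγ_red (hη_box.and hη_zero) }

end IsBifurcationPoint

/-! ## Planar configurations -/

theorem dist_vec_two (a b a' b' : ℝ) :
    dist (!₂[a, b] : EuclideanSpace ℝ (Fin 2)) !₂[a', b'] = √((a - a') ^ 2 + (b - b') ^ 2) := by
  simp [EuclideanSpace.dist_eq, Real.dist_eq, sq_abs]

section Triangle

variable {c p h u v : ℝ} {s : Set (EuclideanSpace ℝ (Fin 2))}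

theorem mem_convexHull_triangle (hc : 0 < c) (hh : 0 < h) (hv : 0 ≤ v) (hleft : v * p ≤ u * h)
    (hright : v * (c - p) ≤ (c - u) * h) (h0 : !₂[0, 0] ∈ s) (h1 : !₂[c, 0] ∈ s)
    (h2 : !₂[p, h] ∈ s) : !₂[u, v] ∈ convexHull ℝ s := by
  set weight : Fin 3 → ℝ :=
    ![((c - u) * h - v * (c - p)) / (c * h), (u * h - v * p) / (c * h), v / h] with hweight
  set vertex : Fin 3 → EuclideanSpace ℝ (Fin 2) := ![!₂[0, 0], !₂[c, 0], !₂[p, h]] with hvertex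
  have hcomb : !₂[u, v] = ∑ i, weight i • vertex i := by
    refine PiLp.ext (Fin.forall_fin_two.2 ⟨?_, ?_⟩) <;>
    · simp only [hweight, hvertex, Fin.sum_univ_three, PiLp.add_apply, PiLp.smul_apply,
        Matrix.cons_val, smul_eq_mul]
      field_simp
      ring
  rw [hcomb]
  refine (convex_convexHull ℝ s).sum_mem (fun i _ => ?_) ?_
    (fun i _ => subset_convexHull ℝ s (by fin_cases i; exacts [h0, h1, h2]))
  · fin_cases i
    exacts [div_nonneg (sub_nonneg.2 hright) (by positivity),
      div_nonneg (sub_nonneg.2 hleft) (by positivity), div_nonneg hv hh.le]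
  · simp only [hweight, Fin.sum_univ_three, Matrix.cons_val]
    field_simp
    ring

theorem mem_interior_convexHull_triangle (hc : 0 < c) (hh : 0 < h) (hv : 0 < v)
    (hleft : v * p < u * h) (hright : v * (c - p) < (c - u) * h) (h0 : !₂[0, 0] ∈ s)
    (h1 : !₂[c, 0] ∈ s) (h2 : !₂[p, h] ∈ s) : !₂[u, v] ∈ interior (convexHull ℝ s) := by
  refine mem_interior.2 ⟨{z | 0 < z 1 ∧ z 1 * p < z 0 * h ∧ z 1 * (c - p) < (c - z 0) * h},
    ?_, ?_, by simpa using ⟨hv, hleft, hright⟩⟩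
  · rintro z ⟨hz, hz_left, hz_right⟩
    have := mem_convexHull_triangle hc hh hz.le hz_left.le hz_right.le h0 h1 h2
    convert this using 1
    ext i
    fin_cases i <;> rfl
  · refine (isOpen_lt ?_ ?_).and ((isOpen_lt ?_ ?_).and (isOpen_lt ?_ ?_)) <;> fun_prop

end Triangle

section Planar

variable {x : Vec}

/-- Planar configurations with mutual distances `x`, in coordinates where the bodies are at
`(0, 0)`, `(x 2, 0)`, `(p, y)` and `(p', y')`. -/
structure IsPlanar (x : Vec) (p y p' y' : ℝ) : Prop where
  dist₁₃ : p ^ 2 + y ^ 2 = x 3 ^ 2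
  dist₁₄ : p' ^ 2 + y' ^ 2 = x 4 ^ 2
  dist₂₃ : (x 2 - p) ^ 2 + y ^ 2 = x 5 ^ 2
  dist₂₄ : (x 2 - p') ^ 2 + y' ^ 2 = x 6 ^ 2
  dist₃₄ : (p - p') ^ 2 + (y - y') ^ 2 = x 7 ^ 2

theorem IsPlanar.bodyInside {p y p' y' : ℝ} (h : IsPlanar x p y p' y') (hx : ∀ k, 2 ≤ k → 0 < x k)
    (hy : 0 < y) (hy' : 0 < y') (hleft : y * p' < p * y')
    (hright : y * (x 2 - p') < (x 2 - p) * y') : BodyInside 2 x := by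
  have hdist {a b a' b' : ℝ} (k : Fin 8) (heq : (a - a') ^ 2 + (b - b') ^ 2 = x k ^ 2)
      (hk : 2 ≤ k := by decide) :
      dist (!₂[a, b] : EuclideanSpace ℝ (Fin 2)) !₂[a', b'] = x k := by
    rw [dist_vec_two, heq, Real.sqrt_sq (hx k hk).le]
  exact ⟨![!₂[0, 0], !₂[x 2, 0], !₂[p, y], !₂[p', y']], hdist 2 (by ring),
    hdist 3 (by linear_combination h.dist₁₃), hdist 4 (by linear_combination h.dist₁₄),
    hdist 5 (by linear_combination h.dist₂₃), hdist 6 (by linear_combination h.dist₂₄),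
    hdist 7 h.dist₃₄, mem_interior_convexHull_triangle (hx 2 le_rfl) hy' hy hleft hright
      ⟨0, by decide, rfl⟩ ⟨1, by decide, rfl⟩ ⟨3, by decide, rfl⟩⟩

theorem isPlanar_of_cmDet_eq_zero (hx₂ : x 2 ≠ 0) {p p' : ℝ}
    (hp : 2 * x 2 * p = x 2 ^ 2 + x 3 ^ 2 - x 5 ^ 2)
    (hp' : 2 * x 2 * p' = x 2 ^ 2 + x 4 ^ 2 - x 6 ^ 2)
    (hy : 0 ≤ x 3 ^ 2 - p ^ 2) (hy' : 0 ≤ x 4 ^ 2 - p' ^ 2)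
    (hinner : 0 ≤ x 3 ^ 2 + x 4 ^ 2 - x 7 ^ 2 - 2 * p * p') (h : cmDet x = 0) :
    IsPlanar x p (√(x 3 ^ 2 - p ^ 2)) p' (√(x 4 ^ 2 - p' ^ 2)) := by
  have hsq := Real.sq_sqrt hy
  have hsq' := Real.sq_sqrt hy'
  have hinner_sq : (x 3 ^ 2 + x 4 ^ 2 - x 7 ^ 2 - 2 * p * p') ^ 2 =
      (2 * √(x 3 ^ 2 - p ^ 2) * √(x 4 ^ 2 - p' ^ 2)) ^ 2 := by
    have hp_eq : p = (x 2 ^ 2 + x 3 ^ 2 - x 5 ^ 2) / (2 * x 2) := by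
      field_simp
      linear_combination hp
    have hp'_eq : p' = (x 2 ^ 2 + x 4 ^ 2 - x 6 ^ 2) / (2 * x 2) := by
      field_simp
      linear_combination hp'
    rw [mul_pow, mul_pow, hsq, hsq', hp_eq, hp'_eq]
    simp only [cmDet_eq_eval, cmPoly, eval_add, eval_mul, eval_sub, eval_pow, eval_var,
      eval_ofNat] at h
    field_simp
    linear_combination (-2 * x 2 ^ 2) * h
  have hinner_eq := (pow_left_inj₀ hinner (by positivity) two_ne_zero).1 hinner_sq
  constructor
  · linear_combination hsq
  · linear_combination hsq'
  · linear_combination hsq - hp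
  · linear_combination hsq' - hp'
  · linear_combination hsq + hsq' + hinner_eq

end Planar

section Box

variable {x : Vec}

theorem abs_sub_lt_of_mem_vecBox (hx : x ∈ vecBox) (k : Fin 8) :
    |x k - ![4.0773, 0.7772, 1.0135, 0.5762, 0.9952, 0.5762, 0.9952, 0.5822] k| < 0.0001 := by
  refine (abs_sub_le _ (toVec (fun i => (boxCenter i : ℝ)) 0 k) _).trans_lt ?_
  have hcenter : |toVec (fun i => (boxCenter i : ℝ)) 0 k -
      ![4.0773, 0.7772, 1.0135, 0.5762, 0.9952, 0.5762, 0.9952, 0.5822] k| ≤ 0.00009 := by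
    simp only [toVec, assemble_apply, Function.comp_apply, mul_zero, sub_zero, add_zero]
    fin_cases k <;> norm_num [symm, boxCenter, abs_le, Fin.castLE]
  have hradius := mem_vecBox.1 hx k
  norm_num [configRadius] at hradius hcenter ⊢
  linarith

theorem pos_of_mem_vecBox (hx : x ∈ vecBox) (k : Fin 8) : 0 < x k := by
  have h := (abs_lt.1 (abs_sub_lt_of_mem_vecBox hx k)).1
  fin_cases k <;> norm_num at h ⊢ <;> linarith

theorem bounds_of_mem_vecBox (hx : x ∈ vecBox) :
    x 2 ∈ Set.Ioo 1.0134 1.0136 ∧ (x 3 ∈ Set.Ioo 0.5761 0.5763 ∧ x 5 ∈ Set.Ioo 0.5761 0.5763) ∧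
      (x 4 ∈ Set.Ioo 0.9951 0.9953 ∧ x 6 ∈ Set.Ioo 0.9951 0.9953) ∧
      x 7 ∈ Set.Ioo 0.5821 0.5823 := by
  have hIoo (k : Fin 8) {l u : ℝ}
      (hl : l = ![4.0773, 0.7772, 1.0135, 0.5762, 0.9952, 0.5762, 0.9952, 0.5822] k - 0.0001)
      (hu : u = ![4.0773, 0.7772, 1.0135, 0.5762, 0.9952, 0.5762, 0.9952, 0.5822] k + 0.0001) :
      x k ∈ Set.Ioo l u := by
    obtain ⟨hlow, hupp⟩ := abs_lt.1 (abs_sub_lt_of_mem_vecBox hx k)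
    constructor <;> linarith
  refine ⟨hIoo 2 ?_ ?_, ⟨hIoo 3 ?_ ?_, hIoo 5 ?_ ?_⟩, ⟨hIoo 4 ?_ ?_, hIoo 6 ?_ ?_⟩,
    hIoo 7 ?_ ?_⟩ <;> simp only [Matrix.cons_val] <;> norm_num

theorem mem_Ioo_of_two_mul_mul_eq {c r r' p : ℝ} (hc : c ∈ Set.Ioo 1.0134 1.0136)
    (hr : 0 < r) (hr' : 0 < r') (hsum : r + r' < 2) (hdiff : |r - r'| < 0.0002)
    (hp : 2 * c * p = c ^ 2 + r ^ 2 - r' ^ 2) : p ∈ Set.Ioo 0.506 0.508 := by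
  have hsq : |r ^ 2 - r' ^ 2| < 2 * 0.0002 := by
    rw [sq_sub_sq, abs_mul, abs_of_pos (add_pos hr hr')]
    exact mul_lt_mul'' hsum hdiff (add_pos hr hr').le (abs_nonneg _)
  rw [abs_lt] at hsq
  norm_num at hc hsq ⊢
  constructor <;> nlinarith

theorem sq_mem_Ioo {z l u : ℝ} (hl : 0 ≤ l) (hz : z ∈ Set.Ioo l u) :
    z ^ 2 ∈ Set.Ioo (l ^ 2) (u ^ 2) :=
  ⟨pow_lt_pow_left₀ hz.1 hl two_ne_zero, pow_lt_pow_left₀ hz.2 (hl.trans hz.1.le) two_ne_zero⟩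

theorem bodyInside_of_mem_vecBox (hx : x ∈ vecBox) (h : cmDet x = 0) : BodyInside 2 x := by
  have hpos := pos_of_mem_vecBox hx
  obtain ⟨hx₂, ⟨hx₃, hx₅⟩, ⟨hx₄, hx₆⟩, hx₇⟩ := bounds_of_mem_vecBox hx
  obtain ⟨p, hp⟩ : ∃ p, 2 * x 2 * p = x 2 ^ 2 + x 3 ^ 2 - x 5 ^ 2 :=
    ⟨_, mul_div_cancel₀ _ (by simp [(hpos 2).ne'])⟩
  obtain ⟨p', hp'⟩ : ∃ p', 2 * x 2 * p' = x 2 ^ 2 + x 4 ^ 2 - x 6 ^ 2 :=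
    ⟨_, mul_div_cancel₀ _ (by simp [(hpos 2).ne'])⟩
  have hpI : p ∈ Set.Ioo 0.506 0.508 := mem_Ioo_of_two_mul_mul_eq hx₂ (hpos 3) (hpos 5)
    (by linarith [hx₃.2, hx₅.2])
    (abs_sub_lt_iff.2 ⟨by linarith [hx₃.2, hx₅.1], by linarith [hx₃.1, hx₅.2]⟩) hp
  have hpI' : p' ∈ Set.Ioo 0.506 0.508 := mem_Ioo_of_two_mul_mul_eq hx₂ (hpos 4) (hpos 6)
    (by linarith [hx₄.2, hx₆.2])
    (abs_sub_lt_iff.2 ⟨by linarith [hx₄.2, hx₆.1], by linarith [hx₄.1, hx₆.2]⟩) hp'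
  have hp_sq := sq_mem_Ioo (by norm_num) hpI
  have hp'_sq := sq_mem_Ioo (by norm_num) hpI'
  have hx₃_sq := sq_mem_Ioo (by norm_num) hx₃
  have hx₄_sq := sq_mem_Ioo (by norm_num) hx₄
  have hx₇_sq := sq_mem_Ioo (by norm_num) hx₇
  have hy : 0 < x 3 ^ 2 - p ^ 2 := by linarith [hx₃_sq.1, hp_sq.2]
  have hy' : 0.8 ^ 2 < x 4 ^ 2 - p' ^ 2 := by linarith [hx₄_sq.1, hp'_sq.2]
  have hinner : 0 ≤ x 3 ^ 2 + x 4 ^ 2 - x 7 ^ 2 - 2 * p * p' := by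
    linarith [hx₃_sq.1, hx₄_sq.1, hx₇_sq.2, two_mul_le_add_sq p p', hp_sq.2, hp'_sq.2]
  have hsqrt := Real.sqrt_pos.2 hy
  have hsqrt_upp : √(x 3 ^ 2 - p ^ 2) < 0.3 :=
    (Real.sqrt_lt' (by norm_num)).2 (by linarith [hx₃_sq.2, hp_sq.1])
  have hsqrt'_low : 0.8 < √(x 4 ^ 2 - p' ^ 2) := (Real.lt_sqrt (by norm_num)).2 hy'
  refine (isPlanar_of_cmDet_eq_zero (hpos 2).ne' hp hp' hy.le (by linarith) hinner h).bodyInside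
    (fun k _ => hpos k) hsqrt (by linarith) ?_ ?_
  · nlinarith [hpI.1, hpI'.2]
  · nlinarith [hpI.2, hpI'.1, hx₂.1, hx₂.2]

end Box

theorem coords_ne_of_mem_vecBox {x : Vec} (hx : x ∈ vecBox) : x 2 ≠ x 3 ∧ x 2 ≠ x 5 := by
  obtain ⟨hx₂, ⟨hx₃, hx₅⟩, -⟩ := bounds_of_mem_vecBox hx
  norm_num at hx₂ hx₃ hx₅
  constructor <;> intro h <;> linarith

open scoped Classical in
theorem isotropy_of_mem_vecBox {x : Vec} (hx : x ∈ vecBox) :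
    isotropy x = if Phi .g3 x = x then {.e, .g3} else {.e} := by
  obtain ⟨hx₃, hx₅⟩ := coords_ne_of_mem_vecBox hx
  have he : Phi .e x = x := rfl
  have hg1 : Phi .g1 x ≠ x := fun h => hx₃ (congrFun h 2).symm
  have hg2 : Phi .g2 x ≠ x := fun h => hx₅ (congrFun h 2).symm
  have hg4 : Phi .g4 x ≠ x := fun h => hx₃ (congrFun h 2).symm
  have hg5 : Phi .g5 x ≠ x := fun h => hx₅ (congrFun h 2).symm
  split_ifs <;> ext g <;> cases g <;> simp [isotropy, *]

theorem IsBifurcationPoint.symmetryBreakingPitchfork {ρ : Fin 9 → ℝ} (b : IsBifurcationPoint ρ) :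
    SymmetryBreakingPitchfork .g3 2 (toVec ρ 0) (ρ 7) (rightKer ρ) := by
  obtain ⟨γ, hγ, hγ_zero, hγ_red⟩ := b.exists_curve
  obtain ⟨η, hη, hη_base, hη_red⟩ := b.exists_symmCurve
  have hpair := b.isPitchforkPair hγ hγ_zero hγ_red hη hη_base hη_red
  obtain ⟨W, hWV, ε, δ, hW⟩ := hpair.exists_isIsolating (isOpen_vecBox.mem_nhds b.vec)
  have hPhi (t : ℝ) : Phi .g3 (toVec (γ (t ^ 2)) t) = toVec (γ ((-t) ^ 2)) (-t) := by
    rw [Phi_g3_toVec, neg_sq]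
  refine ⟨W, ε, δ, _, _, _, hpair.isSupercriticalPitchfork hW, ?_, fun μ hμ => ?_,
    fun t ht ht0 => ?_, fun t _ => ⟨hPhi t, hpair.τ_even t⟩, fun μ _ z hz h => ?_⟩
  · rw [deriv_toVec_comp_sq (hγ.differentiableAt (by simp)), hγ_zero]
  · rw [isotropy_of_mem_vecBox (hWV (hW.s_zero μ hμ).1), if_pos (Phi_g3_toVec_zero _)]
  · refine (isotropy_of_mem_vecBox (hWV (hW.y_zero t ht).1)).trans (if_neg fun hfix => ht0 ?_)
    have hskew := congrArg skew hfix
    rw [Phi_g3_toVec, skew_toVec, skew_toVec] at hskew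
    exact neg_eq_self.1 hskew
  · exact bodyInside_of_mem_vecBox (hWV hz) (congrFun h 1)

/-! ## Relabelling the bodies -/

section Equivariance

variable {E E' : Type*} [NormedAddCommGroup E] [NormedSpace ℝ E] [NormedAddCommGroup E']
  [NormedSpace ℝ E']

theorem fderiv_map_of_equivariant {f : E → E} (L : E ≃L[ℝ] E) (hL : ∀ z, f (L z) = L (f z))
    (x u : E) : fderiv ℝ f (L x) (L u) = L (fderiv ℝ f x u) := by
  have hcomp : f ∘ L = L ∘ f := funext hL
  have hderiv := congrArg (fun g => fderiv ℝ g x u) hcomp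
  rwa [L.comp_right_fderiv, L.comp_fderiv] at hderiv

theorem iteratedFDeriv_map_of_equivariant {n : ℕ} {f : E → E} (hf : ContDiff ℝ n f)
    (L : E ≃L[ℝ] E) (hL : ∀ z, f (L z) = L (f z)) (x : E) (u : Fin n → E) :
    iteratedFDeriv ℝ n f (L x) (fun i => L (u i)) = L (iteratedFDeriv ℝ n f x u) := by
  have hcomp : f ∘ (L : E →L[ℝ] E) = L ∘ f := funext hL
  have hderiv := congrArg (fun g => iteratedFDeriv ℝ n g x u) hcomp
  rw [ContinuousLinearMap.iteratedFDeriv_comp_right _ hf x le_rfl,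
    L.iteratedFDeriv_comp_left] at hderiv
  exact hderiv

theorem deriv_continuousLinearEquiv_comp (L : E ≃L[ℝ] E') (f : ℝ → E) (s : ℝ) :
    deriv (fun t => L (f t)) s = L (deriv f s) :=
  congrArg (fun A : ℝ →L[ℝ] E' => A 1) (L.comp_fderiv (f := f) (x := s))

theorem IsSupercriticalPitchfork.map {F : E → ℝ → E} {F' : E' → ℝ → E'} (L : E ≃L[ℝ] E')
    (hF : ∀ x μ, F' (L x) μ = 0 ↔ F x μ = 0) {x₀ : E} {μ₀ : ℝ} {W : Set E} {ε δ : ℝ}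
    {s y : ℝ → E} {τ : ℝ → ℝ} (h : IsSupercriticalPitchfork F x₀ μ₀ W ε δ s y τ) :
    IsSupercriticalPitchfork F' (L x₀) μ₀ (L '' W) ε δ (fun μ => L (s μ)) (fun t => L (y t)) τ := by
  have hzeros (μ : ℝ) : {z ∈ L '' W | F' z μ = 0} = L '' {z ∈ W | F z μ = 0} := by
    ext z
    obtain ⟨z, rfl⟩ := L.surjective z
    simp [L.injective.mem_set_image, hF]
  exact
    { isOpen := L.toHomeomorph.isOpenMap _ h.isOpen
      mem := Set.mem_image_of_mem L h.mem
      ε_pos := h.ε_pos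
      δ_pos := h.δ_pos
      s_smooth := L.contDiff.comp_contDiffOn h.s_smooth
      s_base := congrArg L h.s_base
      y_smooth := L.contDiff.comp_contDiffOn h.y_smooth
      τ_smooth := h.τ_smooth
      y_base := congrArg L h.y_base
      τ_base := h.τ_base
      y_tangent := by simpa [deriv_continuousLinearEquiv_comp] using h.y_tangent
      τ_tangent := h.τ_tangent
      τ_bend := h.τ_bend
      y_zero := fun t ht => ⟨Set.mem_image_of_mem L (h.y_zero t ht).1, (hF _ _).2 (h.y_zero t ht).2⟩
      below := fun μ hμ => by rw [hzeros, h.below μ hμ, Set.image_singleton]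
      above := fun μ hμ => by
        obtain ⟨t₁, ht₁, t₂, ht₂, hτ₁, hτ₂, heq, hcard⟩ := h.above μ hμ
        refine ⟨t₁, ht₁, t₂, ht₂, hτ₁, hτ₂, ?_, ?_⟩
        · rw [hzeros, heq, Set.image_insert_eq, Set.image_pair]
        · rw [hzeros, Set.ncard_image_of_injective _ L.injective, hcard] }

end Equivariance

theorem ker_submatrix_eq_span {R n : Type*} [CommRing R] [Fintype n] {A : Matrix n n R} {v : n → R}
    (σ : Equiv.Perm n) (h : LinearMap.ker A.mulVecLin = Submodule.span R {v}) :
    LinearMap.ker (A.submatrix σ σ).mulVecLin = Submodule.span R {v ∘ σ} := by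
  ext u
  have hker : A *ᵥ (u ∘ σ.symm) = 0 ↔ u ∘ σ.symm ∈ Submodule.span R {v} := by
    rw [← h, LinearMap.mem_ker, Matrix.mulVecLin_apply]
  rw [LinearMap.mem_ker, Matrix.mulVecLin_apply, Matrix.submatrix_mulVec_equiv,
    Submodule.mem_span_singleton]
  rw [Submodule.mem_span_singleton] at hker
  rw [← Pi.zero_comp, σ.surjective.injective_comp_right.eq_iff, hker]
  simp only [Equiv.eq_comp_symm]
  rfl

/-- Relabelling of the unknowns by a permutation. -/
noncomputable def relabel (σ : Equiv.Perm (Fin 8)) : Vec ≃L[ℝ] Vec :=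
  (LinearEquiv.funCongrLeft ℝ ℝ σ).toContinuousLinearEquiv

section Relabel

variable {σ : Equiv.Perm (Fin 8)}

theorem relabel_apply (σ : Equiv.Perm (Fin 8)) (z : Vec) : relabel σ z = z ∘ σ := rfl

theorem relabel_dotProduct (σ : Equiv.Perm (Fin 8)) (w z : Vec) :
    relabel σ w ⬝ᵥ relabel σ z = w ⬝ᵥ z :=
  comp_equiv_dotProduct_comp_equiv w z σ

theorem partialDeriv_relabel {f : Vec → ℝ} (hf : ∀ z, f (relabel σ z) = f z) (k : Fin 8) (z : Vec) :
    partialDeriv f k (relabel σ z) = partialDeriv f (σ k) z := by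
  have hupdate (t : ℝ) :
      Function.update (relabel σ z) k t = relabel σ (Function.update z (σ k) t) :=
    (Function.update_comp_eq_of_injective z σ.injective k t).symm
  simp only [partialDeriv, hupdate, hf]
  rfl

theorem dziobek_relabel (h0 : σ 0 = 0) (h1 : σ 1 = 1)
    (hmass : ∀ m i, pairMass m (σ i) = pairMass m i)
    (hdet : ∀ z, cmDet (relabel σ z) = cmDet z) (z : Vec) (m : ℝ) :
    dziobek (relabel σ z) m = relabel σ (dziobek z m) := by
  ext k
  have hfix0 (i : Fin 8) : σ i = 0 ↔ i = 0 := by rw [← σ.apply_eq_iff_eq (x := i), h0]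
  have hfix1 (i : Fin 8) : σ i = 1 ↔ i = 1 := by rw [← σ.apply_eq_iff_eq (x := i), h1]
  have hdist (i : Fin 8) : 2 ≤ i ↔ i ≠ 0 ∧ i ≠ 1 := by decide +revert
  have hsum : ∑ l ∈ Finset.Ici (2 : Fin 8), pairMass m l * relabel σ z l ^ 2 =
      ∑ l ∈ Finset.Ici (2 : Fin 8), pairMass m l * z l ^ 2 := by
    refine Finset.sum_equiv σ (fun i => by simp [hdist, hfix0, hfix1]) fun i _ => ?_
    rw [hmass, relabel_apply, Function.comp_apply]
  simp only [relabel_apply σ (dziobek z m), Function.comp_apply, dziobek, hsum, hdet,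
    partialDeriv_relabel hdet, hfix0, hfix1, hmass]
  simp only [relabel_apply, Function.comp_apply, h0, h1]

end Relabel

/-- The permutation `σ` of the unknowns is a symmetry of the Dziobek equations that conjugates the
action of the dihedral group by `c`, and takes configurations with the body `k` inside to
configurations with the body `k'` inside. -/
structure IsSymmetry (σ : Equiv.Perm (Fin 8)) (c : D6 ≃ D6) (k k' : Fin 4) : Prop where
  equivariant : ∀ z m, dziobek (relabel σ z) m = relabel σ (dziobek z m)
  conj : ∀ g z, Phi (c g) (relabel σ z) = relabel σ (Phi g z)
  conj_e : c .e = .e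
  bodyInside : ∀ z, BodyInside k z → BodyInside k' (relabel σ z)

namespace IsSymmetry

variable {σ : Equiv.Perm (Fin 8)} {c : D6 ≃ D6} {k k' : Fin 4} {x v w : Vec} {m : ℝ} {g : D6}

theorem fderiv_relabel (hσ : IsSymmetry σ c k k') (x : Vec) (m : ℝ) (u : Vec) :
    fderiv ℝ (fun z => dziobek z m) (relabel σ x) (relabel σ u) =
      relabel σ (fderiv ℝ (fun z => dziobek z m) x u) :=
  fderiv_map_of_equivariant (relabel σ) (fun z => hσ.equivariant z m) x u

theorem iteratedFDeriv_relabel (hσ : IsSymmetry σ c k k') {n : ℕ} (x : Vec) (m : ℝ)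
    (u : Fin n → Vec) :
    iteratedFDeriv ℝ n (fun z => dziobek z m) (relabel σ x) (relabel σ ∘ u) =
      relabel σ (iteratedFDeriv ℝ n (fun z => dziobek z m) x u) :=
  iteratedFDeriv_map_of_equivariant ((contDiff_dziobek_left m).of_le (by exact_mod_cast le_top))
    (relabel σ) (fun z => hσ.equivariant z m) x u

theorem jacobian_relabel (hσ : IsSymmetry σ c k k') (x : Vec) (m : ℝ) :
    jacobian (relabel σ x) m = (jacobian x m).submatrix σ σ := by
  refine Matrix.mulVec_injective (funext fun u => ?_)
  obtain ⟨u, rfl⟩ := (relabel σ).surjective u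
  rw [jacobian_mulVec, hσ.fderiv_relabel, ← jacobian_mulVec, Matrix.submatrix_mulVec_equiv,
    relabel_apply, relabel_apply, Function.comp_assoc, Equiv.self_comp_symm, Function.comp_id]

theorem pitchforkConditions (hσ : IsSymmetry σ c k k') (h : PitchforkConditions g x m v w) :
    PitchforkConditions (c g) (relabel σ x) m (relabel σ v) (relabel σ w) where
  v_ne := (map_ne_zero_iff _ (relabel σ).injective).2 h.v_ne
  w_ne := (map_ne_zero_iff _ (relabel σ).injective).2 h.w_ne
  ker := by
    rw [hσ.jacobian_relabel]
    exact ker_submatrix_eq_span σ h.ker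
  coker := by
    rw [hσ.jacobian_relabel, Matrix.transpose_submatrix]
    exact ker_submatrix_eq_span σ h.coker
  fix := by rw [hσ.conj, h.fix]
  anti := by rw [hσ.conj, h.anti, map_neg]
  first := by
    simp only [hσ.equivariant]
    rw [deriv_continuousLinearEquiv_comp, relabel_dotProduct, h.first]
  mixed := by
    simp only [hσ.fderiv_relabel]
    rw [deriv_continuousLinearEquiv_comp, relabel_dotProduct]
    exact h.mixed
  second := by
    have hvec : ![relabel σ v, relabel σ v] = relabel σ ∘ ![v, v] := by
      ext i; fin_cases i <;> rfl
    rw [hvec, hσ.iteratedFDeriv_relabel, relabel_dotProduct, h.second]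
  third := by
    have hvec : ![relabel σ v, relabel σ v, relabel σ v] = relabel σ ∘ ![v, v, v] := by
      ext i; fin_cases i <;> rfl
    rw [hvec, hσ.iteratedFDeriv_relabel, relabel_dotProduct]
    exact h.third

theorem isotropy_relabel (hσ : IsSymmetry σ c k k') (x : Vec) :
    isotropy (relabel σ x) = c '' isotropy x := by
  ext a
  obtain ⟨a, rfl⟩ := c.surjective a
  rw [c.injective.mem_set_image, isotropy, isotropy, Set.mem_ofPred_eq, Set.mem_ofPred_eq, hσ.conj,
    (relabel σ).injective.eq_iff]

theorem dziobek_relabel_eq_zero_iff (hσ : IsSymmetry σ c k k') (z : Vec) (μ : ℝ) :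
    dziobek (relabel σ z) μ = 0 ↔ dziobek z μ = 0 := by
  rw [hσ.equivariant, map_eq_zero_iff _ (relabel σ).injective]

theorem symmetryBreakingPitchfork (hσ : IsSymmetry σ c k k')
    (h : SymmetryBreakingPitchfork g k x m v) :
    SymmetryBreakingPitchfork (c g) k' (relabel σ x) m (relabel σ v) := by
  obtain ⟨W, ε, δ, s, y, τ, h, hv, hs, hy, hg, hinside⟩ := h
  refine ⟨_, ε, δ, _, _, τ, h.map (relabel σ) hσ.dziobek_relabel_eq_zero_iff, ?_,
    fun μ hμ => ?_, fun t ht ht0 => ?_, fun t ht => ⟨?_, (hg t ht).2⟩, ?_⟩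
  · rw [deriv_continuousLinearEquiv_comp, hv]
  · rw [hσ.isotropy_relabel, hs μ hμ, Set.image_pair, hσ.conj_e]
  · rw [hσ.isotropy_relabel, hy t ht ht0, Set.image_singleton, hσ.conj_e]
  · rw [hσ.conj, (hg t ht).1]
  · rintro μ hμ _ ⟨z, hz, rfl⟩ hzero
    exact hσ.bodyInside z (hinside μ hμ z hz ((hσ.dziobek_relabel_eq_zero_iff z μ).1 hzero))

end IsSymmetry

/-- The permutation of the unknowns by which the transposition of the bodies 2 and 3 acts. -/
def unknownPerm₁ : Equiv.Perm (Fin 8) := Equiv.swap 2 3 * Equiv.swap 6 7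

/-- The permutation of the unknowns by which the transposition of the bodies 1 and 3 acts. -/
def unknownPerm₂ : Equiv.Perm (Fin 8) := Equiv.swap 2 5 * Equiv.swap 4 7

theorem relabel_unknownPerm₁ (z : Vec) : relabel unknownPerm₁ z = Phi .g1 z := by
  ext i
  fin_cases i <;> rfl

theorem relabel_unknownPerm₂ (z : Vec) : relabel unknownPerm₂ z = Phi .g2 z := by
  ext i
  fin_cases i <;> rfl

/-- Conjugation by `g1` in the dihedral group. -/
def conj₁ : D6 → D6
  | .e => .e | .g1 => .g1 | .g2 => .g3 | .g3 => .g2 | .g4 => .g5 | .g5 => .g4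

/-- Conjugation by `g2` in the dihedral group. -/
def conj₂ : D6 → D6
  | .e => .e | .g1 => .g3 | .g2 => .g2 | .g3 => .g1 | .g4 => .g5 | .g5 => .g4

theorem conj₁_involutive : Function.Involutive conj₁ := by rintro ⟨⟩ <;> rfl

theorem conj₂_involutive : Function.Involutive conj₂ := by rintro ⟨⟩ <;> rfl

theorem cmDet_eq_of_cayleyMenger_eq_submatrix {x z : Vec} (e : Equiv.Perm (Fin 5))
    (h : cayleyMenger x = (cayleyMenger z).submatrix e e) : cmDet x = cmDet z := by
  rw [cmDet, cmDet, h, Matrix.det_submatrix_equiv_self]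

theorem cmDet_relabel_unknownPerm₁ (z : Vec) : cmDet (relabel unknownPerm₁ z) = cmDet z := by
  rw [relabel_unknownPerm₁]
  refine cmDet_eq_of_cayleyMenger_eq_submatrix (Equiv.swap 2 3) ?_
  ext i j
  fin_cases i <;> fin_cases j <;> simp [cayleyMenger, Phi, Equiv.swap_apply_def]

theorem cmDet_relabel_unknownPerm₂ (z : Vec) : cmDet (relabel unknownPerm₂ z) = cmDet z := by
  rw [relabel_unknownPerm₂]
  refine cmDet_eq_of_cayleyMenger_eq_submatrix (Equiv.swap 1 3) ?_
  ext i j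
  fin_cases i <;> fin_cases j <;> simp [cayleyMenger, Phi, Equiv.swap_apply_def]

theorem image_comp_swap_compl {ι α : Type*} [DecidableEq ι] (q : ι → α) (i j : ι) :
    (q ∘ Equiv.swap i j) '' {j}ᶜ = q '' {i}ᶜ := by
  rw [Set.image_comp, Set.image_compl_eq (Equiv.bijective _), Set.image_singleton,
    Equiv.swap_apply_right]

theorem pairMass_unknownPerm₁ (m : ℝ) (i : Fin 8) :
    pairMass m (unknownPerm₁ i) = pairMass m i := by
  fin_cases i <;> rfl

theorem pairMass_unknownPerm₂ (m : ℝ) (i : Fin 8) :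
    pairMass m (unknownPerm₂ i) = pairMass m i := by
  fin_cases i <;> rfl

theorem Phi_conj₁ (g : D6) (z : Vec) : Phi (conj₁ g) (Phi .g1 z) = Phi .g1 (Phi g z) := by
  cases g <;> simp [Phi, conj₁]

theorem Phi_conj₂ (g : D6) (z : Vec) : Phi (conj₂ g) (Phi .g2 z) = Phi .g2 (Phi g z) := by
  cases g <;> simp [Phi, conj₂]

theorem BodyInside.phi_g1 {z : Vec} (h : BodyInside 2 z) : BodyInside 1 (Phi .g1 z) := by
  obtain ⟨q, h01, h02, h03, h12, h13, h23, hmem⟩ := h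
  exact ⟨q ∘ Equiv.swap 2 1, h02, h01, h03, dist_comm (q 1) (q 2) ▸ h12, h23, h13,
    (image_comp_swap_compl q 2 1).symm ▸ hmem⟩

theorem BodyInside.phi_g2 {z : Vec} (h : BodyInside 2 z) : BodyInside 0 (Phi .g2 z) := by
  obtain ⟨q, h01, h02, h03, h12, h13, h23, hmem⟩ := h
  exact ⟨q ∘ Equiv.swap 2 0, dist_comm (q 1) (q 2) ▸ h12, dist_comm (q 0) (q 2) ▸ h02, h23,
    dist_comm (q 0) (q 1) ▸ h01, h13, h03, (image_comp_swap_compl q 2 0).symm ▸ hmem⟩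

theorem isSymmetry₁ : IsSymmetry unknownPerm₁ (conj₁_involutive.toPerm conj₁) 2 1 where
  equivariant := dziobek_relabel rfl rfl pairMass_unknownPerm₁ cmDet_relabel_unknownPerm₁
  conj g z := by
    simpa only [relabel_unknownPerm₁, Function.Involutive.coe_toPerm] using Phi_conj₁ g z
  conj_e := rfl
  bodyInside z h := relabel_unknownPerm₁ z ▸ h.phi_g1

theorem isSymmetry₂ : IsSymmetry unknownPerm₂ (conj₂_involutive.toPerm conj₂) 2 0 where
  equivariant := dziobek_relabel rfl rfl pairMass_unknownPerm₂ cmDet_relabel_unknownPerm₂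
  conj g z := by
    simpa only [relabel_unknownPerm₂, Function.Involutive.coe_toPerm] using Phi_conj₂ g z
  conj_e := rfl
  bodyInside z h := relabel_unknownPerm₂ z ▸ h.phi_g2

theorem PitchforkConditions.det_eq_zero {g : D6} {x v w : Vec} {m : ℝ}
    (h : PitchforkConditions g x m v w) : (jacobian x m).det = 0 := by
  have hmem : v ∈ LinearMap.ker (jacobian x m).mulVecLin := by
    rw [h.ker]
    exact Submodule.mem_span_singleton_self v
  exact Matrix.exists_mulVec_eq_zero_iff.1 ⟨v, h.v_ne, hmem⟩

section NearApproxZero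

variable {ρ : Fin 9 → ℝ} (hρ : ∀ i, |ρ i - approxZero i| ≤ 1 / 10 ^ 26)
include hρ

theorem abs_sub_boxCenter_lt (i : Fin 9) : |ρ i - boxCenter i| < configRadius := by
  have hcenter : |(approxZero i : ℝ) - boxCenter i| ≤ 1 / 10 ^ 13 := by
    simpa using (Rat.cast_le (K := ℝ)).2 (abs_approxZero_sub_boxCenter_le i)
  refine (abs_sub_le _ (approxZero i : ℝ) _).trans_lt ((add_le_add (hρ i) hcenter).trans_lt ?_)
  norm_num [configRadius]

theorem isBifurcationPoint_of_redMap_eq_zero (hz : redMap ρ = 0) : IsBifurcationPoint ρ where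
  nhds := by
    refine Metric.closedBall_mem_nhds_of_mem ((dist_pi_lt_iff boxRadius_pos).2 fun i => ?_)
    exact (abs_sub_boxCenter_lt hρ i).trans (by norm_num [configRadius, boxRadius])
  vec := by
    have hcenter := abs_sub_boxCenter_lt hρ
    refine mem_vecBox.2 fun k => ?_
    simp only [toVec, assemble_apply, Function.comp_apply, mul_zero, sub_zero, add_zero]
    fin_cases k <;> exact hcenter _
  mass := abs_sub_boxCenter_lt hρ 7
  zero := hz

theorem abs_sub_le_of_abs_approxZero_sub_le {i : Fin 9} {c e : ℝ}
    (h : |(approxZero i : ℝ) - c| ≤ e - 1 / 10 ^ 26) : |ρ i - c| ≤ e :=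
  (abs_sub_le _ _ _).trans (by linarith [hρ i])

theorem toVec_zero_mem_xBox : toVec ρ 0 ∈ xBox := by
  simp only [xBox, Set.mem_ofPred_eq, toVec, assemble_apply, Function.comp_apply, Matrix.cons_val,
    mul_zero, sub_zero, add_zero]
  refine ⟨?_, ?_, ?_, ?_, ?_, ?_, ?_, ?_⟩ <;>
  · refine abs_sub_le_of_abs_approxZero_sub_le hρ ?_
    simp only [symm, Fin.castLE, approxZero]
    norm_num [abs_le]

theorem apply_seven_mem_mBox : ρ 7 ∈ mBox := by
  refine abs_sub_le_of_abs_approxZero_sub_le hρ ?_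
  simp only [approxZero, Matrix.cons_val]
  norm_num [abs_le]

end NearApproxZero

theorem abs_sub_lt_of_abs_sub_le {x b c d r : ℝ} (h : |x - c| ≤ d) (hc : |c - b| < r - d) :
    |x - b| < r :=
  (abs_sub_le x c b).trans_lt (by linarith)

theorem xBox_subset_vecBox : xBox ⊆ vecBox := by
  rintro x ⟨h0, h1, h2, h3, h4, h5, h6, h7⟩
  refine mem_vecBox.2 fun k => ?_
  simp only [toVec, assemble_apply, Function.comp_apply, mul_zero, sub_zero, add_zero]
  fin_cases k <;> [refine abs_sub_lt_of_abs_sub_le h0 ?_; refine abs_sub_lt_of_abs_sub_le h1 ?_;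
    refine abs_sub_lt_of_abs_sub_le h2 ?_; refine abs_sub_lt_of_abs_sub_le h3 ?_;
    refine abs_sub_lt_of_abs_sub_le h4 ?_; refine abs_sub_lt_of_abs_sub_le h5 ?_;
    refine abs_sub_lt_of_abs_sub_le h6 ?_; refine abs_sub_lt_of_abs_sub_le h7 ?_] <;>
  norm_num [symm, Fin.castLE, boxCenter, configRadius, abs_lt]

theorem mBox_subset_massBox : mBox ⊆ massBox := fun _ h =>
  abs_sub_lt_of_abs_sub_le h (by
    simp only [boxCenter, configRadius, Matrix.cons_val]
    norm_num [abs_lt])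

theorem eq_toVec_of_isSingularSolution {ρ : Fin 9 → ℝ} (b : IsBifurcationPoint ρ) {x : Vec} {m : ℝ}
    (hx : x ∈ vecBox) (hm : m ∈ massBox) (h : IsSingularSolution x m) :
    x = toVec ρ 0 ∧ m = ρ 7 := by
  obtain ⟨σ, hσ, rfl, rfl, hzero⟩ := h.exists_redMap_eq_zero hx hm
  obtain rfl := injOn_redMap hσ b.mem (hzero.trans b.zero.symm)
  exact ⟨rfl, rfl⟩

end FourBody

theorem mainTheorem3 :
    ∃ (x : FourBody.Vec) (m : ℝ) (v w : FourBody.Vec),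
      (x ∈ FourBody.xBox ∧ m ∈ FourBody.mBox ∧ FourBody.IsSingularSolution x m) ∧
      (∀ (x' : FourBody.Vec) (m' : ℝ), x' ∈ FourBody.xBox → m' ∈ FourBody.mBox →
        FourBody.IsSingularSolution x' m' → x' = x ∧ m' = m) ∧
      v 6 = 1 ∧ w 6 = 1 ∧
      (FourBody.PitchforkConditions .g3 x m v w ∧
        FourBody.SymmetryBreakingPitchfork .g3 2 x m v) ∧
      (FourBody.PitchforkConditions .g2 (FourBody.Phi .g1 x) m
          (FourBody.Phi .g1 v) (FourBody.Phi .g1 w) ∧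
        FourBody.SymmetryBreakingPitchfork .g2 1 (FourBody.Phi .g1 x) m (FourBody.Phi .g1 v)) ∧
      (FourBody.PitchforkConditions .g1 (FourBody.Phi .g2 x) m
          (FourBody.Phi .g2 v) (FourBody.Phi .g2 w) ∧
        FourBody.SymmetryBreakingPitchfork .g1 0 (FourBody.Phi .g2 x) m (FourBody.Phi .g2 v)) := by
  open FourBody in
  obtain ⟨ρ, hρ, hz⟩ := exists_redMap_eq_zero
  have b := isBifurcationPoint_of_redMap_eq_zero hρ hz
  have hc := b.pitchforkConditions
  have hp := b.symmetryBreakingPitchfork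
  refine ⟨toVec ρ 0, ρ 7, rightKer ρ, leftKer ρ,
    ⟨toVec_zero_mem_xBox hρ, apply_seven_mem_mBox hρ, b.dziobek_eq_zero, hc.det_eq_zero⟩,
    fun x m hx hm => eq_toVec_of_isSingularSolution b (xBox_subset_vecBox hx)
      (mBox_subset_massBox hm), by simp [rightKer, assemble_apply],
    by simp [leftKer, assemble_apply], ⟨hc, hp⟩, ?_, ?_⟩
  · simpa only [relabel_unknownPerm₁, Function.Involutive.coe_toPerm, conj₁] using
      And.intro (isSymmetry₁.pitchforkConditions hc) (isSymmetry₁.symmetryBreakingPitchfork hp)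
  · simpa only [relabel_unknownPerm₂, Function.Involutive.coe_toPerm, conj₂] using
      And.intro (isSymmetry₂.pitchforkConditions hc) (isSymmetry₂.symmetryBreakingPitchfork hp)
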